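/- Let $I,J$ be finite non-empty sets, let $\mu_i$ ($i\in I$) and $\nu_j$ ($j\in J$) be positive semidefinite real symmetric $d\times d$ matrices, let $c_{i,j}$ be symmetric real $d\times d$ matrices, and let $\rho_1,\rho_2,\varepsilon>0$. For $P$ symmetric put $H(P)=-\operatorname{tr}(P\log P-P)$ if $P$ is positive semidefinite (with $0\log 0=0$) and $H(P)=-\infty$ otherwise. For $Q$ positive semidefinite put $\mathrm{KL}(P|Q)=\operatorname{tr}(P\log P-P\log Q-P+Q)$ if $P$ is positive semidefinite and $\ker Q\subset\ker P$ (with $0\log 0=0$), and $\mathrm{KL}(P|Q)=+\infty$ otherwise. For $P$ symmetric and $Q$ positive semidefinite let $e^{P+\log Q}$ be the positive semidefinite matrix whose kernel is $\ker Q$ and which on $(\ker Q)^\perp$ equals the exponential of the sum of the compression of $P$ and of $\log Q|_{(\ker Q)^\perp}$. Let $$W_\varepsilon(\mu,\nu)=\min_{\gamma=(\gamma_{i,j})}\ \sum_{i,j}\operatorname{tr}(\gamma_{i,j}c_{i,j}^\top)+\rho_1\sum_i\mathrm{KL}\Big(\sum_j\gamma_{i,j}\Big|\mu_i\Big)+\rho_2\sum_j\mathrm{KL}\Big(\sum_i\gamma_{i,j}\Big|\nu_j\Big)-\varepsilon\sum_{i,j}H(\gamma_{i,j}),$$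 and, for families $u=(u_i)_{i\in I}$, $v=(v_j)_{j\in J}$ of symmetric matrices, let $K(u,v)_{i,j}=-(c_{i,j}+\rho_1u_i+\rho_2v_j)/\varepsilon$ and $$D(u,v)=-\operatorname{tr}\Big[\rho_1\sum_i\big(e^{u_i+\log\mu_i}-\mu_i\big)+\rho_2\sum_j\big(e^{v_j+\log\nu_j}-\nu_j\big)+\varepsilon\sum_{i,j}e^{K(u,v)_{i,j}}\Big].$$ Then the minimum defining $W_\varepsilon(\mu,\nu)$ is attained at exactly one $\gamma$, and $$W_\varepsilon(\mu,\nu)=\sup_{u,v}D(u,v),$$ the supremum being over all families of symmetric matrices. If all $\mu_i$ and $\nu_j$ are positive definite, the supremum is a maximum. If $(u,v)$ maximizes $D$, then $\gamma_{i,j}=\exp(K(u,v)_{i,j})$ for all $(i,j)$; more generally, if $D(u^{(n)},v^{(n)})\to W_\varepsilon(\mu,\nu)$ for a sequence of families of symmetric matrices, then $\exp(K(u^{(n)},v^{(n)})_{i,j})\to\gamma_{i,j}$ for all $(i,j)$. -/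

import Mathlib

open scoped Topology

namespace QOT

/-- Real square matrices of size `d`. -/
abbrev Mat (d : ℕ) : Type := Matrix (Fin d) (Fin d) ℝ

/-- The logarithm of a symmetric matrix, `log (U diag(σ) Uᵀ) = U diag(log σ) Uᵀ`, by functional
calculus. As `Real.log 0 = 0`, for a positive semidefinite matrix this is the logarithm on the
orthogonal complement of the kernel, extended by zero on the kernel. -/
noncomputable def mlog {d : ℕ} (Q : Mat d) : Mat d := cfc Real.log Q

/-- The orthogonal projection onto the range of a symmetric matrix `Q`,
that is, onto the orthogonal complement of its kernel. -/
noncomputable def rangeProj {d : ℕ} (Q : Mat d) : Mat d :=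
  cfc (fun x : ℝ => if x = 0 then 0 else 1) Q

/-- The matrix `exp (P + log Q)` for `P` symmetric and `Q` positive semidefinite: its kernel is the
kernel of `Q`, and on the orthogonal complement of that kernel it is the exponential of
the compression of `P` plus the logarithm of `Q`.
(`rangeProj Q * P * rangeProj Q + mlog Q` is block diagonal with block `0` on the kernel of `Q`;
the last factor replaces the block `exp 0` of its exponential by `0`.) -/
noncomputable def expAddLog {d : ℕ} (P Q : Mat d) : Mat d :=
  NormedSpace.exp (rangeProj Q * P * rangeProj Q + mlog Q) * rangeProj Q

open Classical in
/-- The quantum (von Neumann) entropy of a matrix, `-∞` off the positive semidefinite cone. -/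
noncomputable def entropy {d : ℕ} (P : Mat d) : EReal :=
  if P.PosSemidef then ((-(P * mlog P - P).trace : ℝ) : EReal) else ⊥

open Classical in
/-- The quantum Kullback-Leibler divergence (relative entropy) of `P` with respect to the positive
semidefinite matrix `Q`. It is finite exactly if `P` is positive semidefinite and
`ker Q ⊆ ker P`; then `P log Q` is computed with the convention `0 log 0 = 0`. -/
noncomputable def KL {d : ℕ} (P Q : Mat d) : EReal :=
  if P.PosSemidef ∧ ∀ x : Fin d → ℝ, Q.mulVec x = 0 → P.mulVec x = 0 then
    (((P * mlog P - P * mlog Q - P + Q).trace : ℝ) : EReal)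
  else ⊤

section Problem

variable {I J : Type*} [Fintype I] [Fintype J] {d : ℕ}

/-- The objective of the regularized transport problem at the coupling `γ`:
`⟨γ, c⟩ + ρ₁ KL(γ 1_J | μ) + ρ₂ KL(γᵀ 1_I | ν) - ε H(γ)`. -/
noncomputable def primal (c : I → J → Mat d) (μ : I → Mat d) (ν : J → Mat d) (ρ₁ ρ₂ ε : ℝ)
    (γ : I → J → Mat d) : EReal :=
  ((∑ i, ∑ j, (γ i j * (c i j).transpose).trace : ℝ) : EReal)
    + (ρ₁ : EReal) * ∑ i, KL (∑ j, γ i j) (μ i)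
    + (ρ₂ : EReal) * ∑ j, KL (∑ i, γ i j) (ν j)
    - (ε : EReal) * ∑ i, ∑ j, entropy (γ i j)

/-- The value `W_ε(μ, ν)` of the regularized transport problem. -/
noncomputable def W (c : I → J → Mat d) (μ : I → Mat d) (ν : J → Mat d) (ρ₁ ρ₂ ε : ℝ) : EReal :=
  ⨅ γ : I → J → Mat d, primal c μ ν ρ₁ ρ₂ ε γ

/-- `K(u, v)_{i,j} = -(c_{i,j} + ρ₁ u_i + ρ₂ v_j) / ε`. -/
noncomputable def kern (c : I → J → Mat d) (ρ₁ ρ₂ ε : ℝ) (u : I → Mat d) (v : J → Mat d)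
    (i : I) (j : J) : Mat d :=
  -(ε⁻¹ • (c i j + ρ₁ • u i + ρ₂ • v j))

/-- The dual objective. -/
noncomputable def dual (c : I → J → Mat d) (μ : I → Mat d) (ν : J → Mat d) (ρ₁ ρ₂ ε : ℝ)
    (u : I → Mat d) (v : J → Mat d) : ℝ :=
  -(ρ₁ • ∑ i, (expAddLog (u i) (μ i) - μ i)
    + ρ₂ • ∑ j, (expAddLog (v j) (ν j) - ν j)
    + ε • ∑ i, ∑ j, NormedSpace.exp (kern c ρ₁ ρ₂ ε u v i j)).trace

/-- The set of values of the dual objective over all families of symmetric matrices. -/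
def dualValues (c : I → J → Mat d) (μ : I → Mat d) (ν : J → Mat d) (ρ₁ ρ₂ ε : ℝ) : Set EReal :=
  {x | ∃ (u : I → Mat d) (v : J → Mat d), (∀ i, (u i).IsSymm) ∧ (∀ j, (v j).IsSymm) ∧
    x = (dual c μ ν ρ₁ ρ₂ ε u v : EReal)}

/-- `(u, v)` maximizes the dual objective over families of symmetric matrices. -/
def IsDualSolution (c : I → J → Mat d) (μ : I → Mat d) (ν : J → Mat d) (ρ₁ ρ₂ ε : ℝ)
    (u : I → Mat d) (v : J → Mat d) : Prop :=
  (∀ i, (u i).IsSymm) ∧ (∀ j, (v j).IsSymm) ∧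
    ∀ (u' : I → Mat d) (v' : J → Mat d), (∀ i, (u' i).IsSymm) → (∀ j, (v' j).IsSymm) →
      dual c μ ν ρ₁ ρ₂ ε u' v' ≤ dual c μ ν ρ₁ ρ₂ ε u v

end Problem

end QOT

/-! Everything rests on Klein's inequality in the sharpened form `klein`: for `P` positive
semidefinite and `B` symmetric, `tr (P log P - P B - P + exp B)` is at least the squared Frobenius
norm of `√P - exp (B / 2)`. In eigenbases of `P` and `B` it becomes a scalar inequality.

Summed over all terms of the problem, it gives weak duality with a remainder
(`dual_add_le_primalReal`): the gap between a feasible `γ` and a dual pair is at least `ε` times the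
sum of the squared distances between `√γ_ij` and `exp (K_ij / 2)`. Once a feasible `γ` is known
whose value is approached by dual values, strong duality, uniqueness of `γ` and the convergence `exp
K → γ` follow together (`tendsto_exp_kern`).

Such a `γ` is produced by `exists_feasible_no_gap`. The dual need not have a maximizer when the data
are singular, so a penalty `δ/2` times a squared norm is subtracted, which restores compactness. At
a penalized maximizer `z`, the marginals of `exp K` differ from the matrices `exp (u + log μ)`, `exp
(v + log ν)` by `δ z`. The quantity `δ |z|²` stays bounded, so `δ z → 0`, while `exp K` stays
bounded and converges along a subsequence. Before the limit the marginals do not match exactly,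
which is why `primalAux` takes them as separate arguments. Lower semicontinuity of `tr (P log P)`, a
supremum of continuous affine functions by Klein again, closes the gap.

For positive definite data the superlevel sets of the dual are bounded: `exp (u + log μ)` and `exp
(v + log ν)` bound `u` and `v` from above, and `exp K` then bounds them from below. -/

namespace QOT

/-! ### Trace pairing and functional calculus of symmetric matrices. -/

section

variable {d : ℕ}

lemma continuousOn_spectrum (f : ℝ → ℝ) (A : Mat d) : ContinuousOn f (spectrum ℝ A) :=
  (Matrix.finite_real_spectrum (A := A)).continuousOn _

lemma isSelfAdjoint_of_isSymm {A : Mat d} (hA : A.IsSymm) : IsSelfAdjoint A := by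
  rw [isSelfAdjoint_iff, Matrix.star_eq_conjTranspose, Matrix.conjTranspose_eq_transpose_of_trivial]
  exact hA

lemma isSymm_of_isSelfAdjoint {A : Mat d} (hA : IsSelfAdjoint A) : A.IsSymm := by
  rw [isSelfAdjoint_iff, Matrix.star_eq_conjTranspose,
    Matrix.conjTranspose_eq_transpose_of_trivial] at hA
  exact hA

lemma isSymm_cfc (f : ℝ → ℝ) (A : Mat d) : (cfc f A).IsSymm :=
  isSymm_of_isSelfAdjoint (cfc_predicate f A)

lemma isSymm_of_posSemidef {A : Mat d} (hA : A.PosSemidef) : A.IsSymm :=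
  isSymm_of_isSelfAdjoint hA.1

lemma exp_eq_cfc {A : Mat d} (hA : A.IsSymm) : NormedSpace.exp A = cfc Real.exp A := by
  open scoped Matrix.Norms.L2Operator in
  exact (CFC.real_exp_eq_normedSpace_exp (isSelfAdjoint_of_isSymm hA)).symm

lemma continuous_exp : Continuous (NormedSpace.exp : Mat d → Mat d) := by
  open scoped Matrix.Norms.Operator in
  exact NormedSpace.exp_continuous

lemma trace_mul_self_nonneg {A : Mat d} (hA : A.IsSymm) : 0 ≤ (A * A).trace := by
  have h := (Matrix.posSemidef_conjTranspose_mul_self A).trace_nonneg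
  rwa [Matrix.conjTranspose_eq_transpose_of_trivial, hA] at h

lemma trace_mul_self_eq_sum {A : Mat d} (hA : A.IsSymm) :
    (A * A).trace = ∑ a, ∑ b, A a b ^ 2 := by
  simp only [Matrix.trace, Matrix.diag, Matrix.mul_apply]
  refine Finset.sum_congr rfl fun a _ => Finset.sum_congr rfl fun b _ => ?_
  rw [sq, hA.apply]

lemma sq_apply_le_trace_mul_self {A : Mat d} (hA : A.IsSymm) (a b : Fin d) :
    A a b ^ 2 ≤ (A * A).trace := by
  rw [trace_mul_self_eq_sum hA]
  calc A a b ^ 2 ≤ ∑ b, A a b ^ 2 :=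
        Finset.single_le_sum (f := fun b => A a b ^ 2) (fun _ _ => sq_nonneg _) (Finset.mem_univ b)
    _ ≤ _ := Finset.single_le_sum (f := fun a => ∑ b, A a b ^ 2)
        (fun _ _ => Finset.sum_nonneg fun _ _ => sq_nonneg _) (Finset.mem_univ a)

lemma eq_zero_of_trace_mul_self_nonpos {A : Mat d} (hA : A.IsSymm) (h : (A * A).trace ≤ 0) :
    A = 0 := by
  ext a b
  have := sq_apply_le_trace_mul_self hA a b
  exact pow_eq_zero_iff (two_ne_zero) |>.1 (le_antisymm (this.trans h) (sq_nonneg _))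

/-- In eigenbases of `P` and `B` the trace pairing of functions of `P` and `B` is a sum with
nonnegative weights. -/
lemma exists_trace_cfc_mul_cfc {P B : Mat d} (hP : P.IsSymm) (hB : B.IsSymm) :
    ∃ (p b : Fin d → ℝ) (w : Fin d → Fin d → ℝ), (∀ i, p i ∈ spectrum ℝ P) ∧
      (∀ i j, 0 ≤ w i j) ∧ ∀ f g : ℝ → ℝ,
        (cfc f P * cfc g B).trace = ∑ i, ∑ j, w i j * (f (p i) * g (b j)) := by
  have hP' : P.IsHermitian := isSelfAdjoint_of_isSymm hP
  have hB' : B.IsHermitian := isSelfAdjoint_of_isSymm hB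
  set U : Mat d := (hP'.eigenvectorUnitary : Mat d)
  set V : Mat d := (hB'.eigenvectorUnitary : Mat d)
  -- The weights are squared overlaps of eigenvectors. They do not depend on `f` and `g`, so a
  -- scalar inequality between functions of `p i` and `b j` sums to a trace inequality.
  refine ⟨hP'.eigenvalues, hB'.eigenvalues, fun i j => (star U * V) i j ^ 2,
    hP'.eigenvalues_mem_spectrum_real, fun _ _ => sq_nonneg _, fun f g => ?_⟩
  rw [hP'.cfc_eq, hB'.cfc_eq, Matrix.IsHermitian.cfc, Matrix.IsHermitian.cfc,
    Unitary.conjStarAlgAut_apply, Unitary.conjStarAlgAut_apply]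
  change (U * _ * star U * (V * _ * star V)).trace = _
  have h1 : ∀ X Y : Mat d, (U * X * star U * (V * Y * star V)).trace
      = (X * (star U * V) * Y * (star (star U * V))).trace := by
    intro X Y
    rw [mul_assoc U, mul_assoc U, Matrix.trace_mul_comm U, star_mul, star_star]
    simp only [mul_assoc]
  rw [h1]
  simp only [Matrix.trace, Matrix.diag]
  refine Finset.sum_congr rfl fun i _ => ?_
  rw [Matrix.mul_apply]
  refine Finset.sum_congr rfl fun j _ => ?_
  rw [Matrix.mul_diagonal, Matrix.diagonal_mul, Matrix.star_apply]
  simp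
  ring

end

/-! ### Klein's inequality and lower semicontinuity of the entropy. -/

section

variable {d : ℕ}

lemma nonneg_of_mem_spectrum {P : Mat d} (hP : P.PosSemidef) {x : ℝ} (hx : x ∈ spectrum ℝ P) :
    0 ≤ x :=
  (Matrix.posSemidef_iff_isHermitian_and_spectrum_nonneg.1 hP).2 hx

lemma cfc_mul_cfc (f g : ℝ → ℝ) (A : Mat d) : cfc f A * cfc g A = cfc (fun x => f x * g x) A :=
  (cfc_mul f g A (continuousOn_spectrum f A) (continuousOn_spectrum g A)).symm

lemma cfc_one_fun {A : Mat d} (hA : A.IsSymm) : cfc (fun _ : ℝ => (1 : ℝ)) A = 1 :=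
  cfc_const_one ℝ A (isSelfAdjoint_of_isSymm hA)

lemma cfc_id_fun {A : Mat d} (hA : A.IsSymm) : cfc (fun x : ℝ => x) A = A :=
  cfc_id' ℝ A (isSelfAdjoint_of_isSymm hA)

lemma posSemidef_cfc {A : Mat d} {f : ℝ → ℝ} (hf : ∀ x ∈ spectrum ℝ A, 0 ≤ f x) :
    (cfc f A).PosSemidef := by
  have h : cfc f A = cfc (fun x => √(f x)) A * cfc (fun x => √(f x)) A := by
    rw [cfc_mul_cfc]
    exact cfc_congr fun x hx => (Real.mul_self_sqrt (hf x hx)).symm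
  rw [h]
  have := Matrix.posSemidef_conjTranspose_mul_self (cfc (fun x => √(f x)) A)
  rwa [Matrix.conjTranspose_eq_transpose_of_trivial, isSymm_cfc] at this

lemma posSemidef_exp {A : Mat d} (hA : A.IsSymm) : (NormedSpace.exp A).PosSemidef := by
  rw [exp_eq_cfc hA]
  exact posSemidef_cfc fun x _ => (Real.exp_pos x).le

/-- The square root of a positive semidefinite matrix. -/
noncomputable def msqrt (P : Mat d) : Mat d := cfc Real.sqrt P

/-- The square root `exp (B / 2)` of `exp B`. -/
noncomputable def halfExp (B : Mat d) : Mat d := cfc (fun x => Real.exp (x / 2)) B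

lemma msqrt_mul_self {P : Mat d} (hP : P.PosSemidef) : msqrt P * msqrt P = P := by
  rw [msqrt, cfc_mul_cfc]
  conv_rhs => rw [← cfc_id_fun (isSymm_of_posSemidef hP)]
  exact cfc_congr fun x hx => Real.mul_self_sqrt (nonneg_of_mem_spectrum hP hx)

lemma halfExp_mul_self {B : Mat d} (hB : B.IsSymm) : halfExp B * halfExp B = NormedSpace.exp B := by
  rw [halfExp, cfc_mul_cfc, exp_eq_cfc hB]
  refine cfc_congr fun x _ => ?_
  simp only [← Real.exp_add, add_halves]

/-- The trace of `P log P`. -/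
noncomputable def traceMulLog (P : Mat d) : ℝ := (P * mlog P).trace

lemma self_mul_mlog {P : Mat d} (hP : P.IsSymm) : P * mlog P = cfc (fun x => x * Real.log x) P := by
  rw [mlog]
  nth_rewrite 1 [← cfc_id_fun hP]
  rw [cfc_mul_cfc]

/-- For `p > 0` this is `1 + x ≤ exp x` at `x = (b - log p) / 2`, multiplied by `2 p`. The left side
is `(√p - exp (b / 2))²`, expanded. -/
lemma klein_scalar {p : ℝ} (hp : 0 ≤ p) (b : ℝ) :
    (√p * √p) - 2 * (√p * Real.exp (b / 2)) + Real.exp b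
      ≤ p * Real.log p - p * b - p + Real.exp b := by
  rcases hp.eq_or_lt with rfl | hp
  · simp
  have h1 : √p * √p = p := Real.mul_self_sqrt hp.le
  have h2 := Real.add_one_le_exp ((b - Real.log p) / 2)
  have h3 : p * Real.exp ((b - Real.log p) / 2) = √p * Real.exp (b / 2) := by
    have : Real.exp (Real.log p / 2) = √p := by
      rw [Real.sqrt_eq_rpow, Real.rpow_def_of_pos hp]; congr 1; ring
    rw [sub_div, Real.exp_sub, this]
    field_simp
    rw [sq, h1]
  nlinarith [mul_le_mul_of_nonneg_left h2 hp.le]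

/-- Klein's inequality, with a remainder term. -/
lemma klein {P B : Mat d} (hP : P.PosSemidef) (hB : B.IsSymm) :
    ((msqrt P - halfExp B) * (msqrt P - halfExp B)).trace
      ≤ traceMulLog P - (P * B).trace - P.trace + (NormedSpace.exp B).trace := by
  have hPs := isSymm_of_posSemidef hP
  obtain ⟨p, b, w, hp, hw, h⟩ := exists_trace_cfc_mul_cfc hPs hB
  have e0 : ((msqrt P - halfExp B) * (msqrt P - halfExp B)).trace
      = (msqrt P * msqrt P).trace - 2 * (msqrt P * halfExp B).trace
        + (halfExp B * halfExp B).trace := by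
    rw [sub_mul, mul_sub, mul_sub, Matrix.trace_sub, Matrix.trace_sub, Matrix.trace_sub,
      Matrix.trace_mul_comm (halfExp B) (msqrt P)]
    ring
  -- Terms involving only one of the matrices are paired with the constant function `1` of the
  -- other, so that all terms carry the same weights.
  have e1 : (msqrt P * msqrt P).trace = ∑ i, ∑ j, w i j * (√(p i) * √(p i) * 1) := by
    rw [msqrt, cfc_mul_cfc, ← h (fun x => √x * √x) (fun _ => 1), cfc_one_fun hB, mul_one]
  have e2 : (msqrt P * halfExp B).trace = ∑ i, ∑ j, w i j * (√(p i) * Real.exp (b j / 2)) :=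
    h _ _
  have e3 : (NormedSpace.exp B).trace = ∑ i, ∑ j, w i j * (1 * Real.exp (b j)) := by
    rw [exp_eq_cfc hB, ← h (fun _ => 1) Real.exp, cfc_one_fun hPs, one_mul]
  have e4 : traceMulLog P = ∑ i, ∑ j, w i j * (p i * Real.log (p i) * 1) := by
    rw [traceMulLog, self_mul_mlog hPs, ← h (fun x => x * Real.log x) (fun _ => 1),
      cfc_one_fun hB, mul_one]
  have e5 : P.trace = ∑ i, ∑ j, w i j * (p i * 1) := by
    rw [← h (fun x => x) (fun _ => 1), cfc_one_fun hB, mul_one, cfc_id_fun hPs]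
  have e6 : (P * B).trace = ∑ i, ∑ j, w i j * (p i * b j) := by
    rw [← h (fun x => x) (fun x => x), cfc_id_fun hPs, cfc_id_fun hB]
  rw [e0, halfExp_mul_self hB, e1, e2, e3, e4, e5, e6]
  simp only [Finset.mul_sum, ← Finset.sum_add_distrib, ← Finset.sum_sub_distrib]
  refine Finset.sum_le_sum fun i _ => Finset.sum_le_sum fun j _ => ?_
  have := mul_le_mul_of_nonneg_left
    (klein_scalar (nonneg_of_mem_spectrum hP (hp i)) (b j)) (hw i j)
  linarith

lemma isSymm_msqrt (P : Mat d) : (msqrt P).IsSymm := isSymm_cfc _ _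

lemma isSymm_halfExp (P : Mat d) : (halfExp P).IsSymm := isSymm_cfc _ _

lemma isSymm_exp {A : Mat d} (hA : A.IsSymm) : (NormedSpace.exp A).IsSymm :=
  isSymm_of_posSemidef (posSemidef_exp hA)

lemma klein_nonneg {P B : Mat d} (hP : P.PosSemidef) (hB : B.IsSymm) :
    0 ≤ traceMulLog P - (P * B).trace - P.trace + (NormedSpace.exp B).trace :=
  (trace_mul_self_nonneg ((isSymm_msqrt P).sub (isSymm_halfExp B))).trans (klein hP hB)

lemma mlog_exp {B : Mat d} (hB : B.IsSymm) : mlog (NormedSpace.exp B) = B := by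
  open scoped Matrix.Norms.L2Operator in
  exact CFC.log_exp B (isSelfAdjoint_of_isSymm hB)

lemma traceMulLog_exp {B : Mat d} (hB : B.IsSymm) :
    traceMulLog (NormedSpace.exp B) = (NormedSpace.exp B * B).trace := by
  rw [traceMulLog, mlog_exp hB]

/-- `exp A` is a subgradient of the trace of the exponential at `A`. -/
lemma trace_exp_subgradient {A B : Mat d} (hA : A.IsSymm) (hB : B.IsSymm) :
    (NormedSpace.exp A * (B - A)).trace
      ≤ (NormedSpace.exp B).trace - (NormedSpace.exp A).trace := by
  have := klein_nonneg (posSemidef_exp hA) hB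
  rw [traceMulLog_exp hA] at this
  rw [mul_sub, Matrix.trace_sub]
  linarith

/-- The entropy functional is the supremum of the affine functionals in Klein's inequality. -/
lemma exists_lt_affine {P : Mat d} (hP : P.PosSemidef) {η : ℝ} (hη : 0 < η) :
    ∃ B : Mat d, B.IsSymm ∧
      traceMulLog P - η < (P * B).trace + P.trace - (NormedSpace.exp B).trace := by
  have hPs := isSymm_of_posSemidef hP
  -- The optimal choice `B = log P` is not available for singular `P`. With `B = log (P + δ)` the
  -- loss is at most `d * δ`, and the denominator `d + 1` keeps this below `η`, also for `d = 0`.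
  set δ : ℝ := η / (d + 1) with hδ
  have hδ0 : 0 < δ := by positivity
  refine ⟨cfc (fun x => Real.log (x + δ)) P, isSymm_cfc _ _, ?_⟩
  obtain ⟨p, b, w, hp, hw, h⟩ := exists_trace_cfc_mul_cfc hPs hPs
  have e1 : (NormedSpace.exp (cfc (fun x => Real.log (x + δ)) P)).trace
      = ∑ i, ∑ j, w i j * ((p i + δ) * 1) := by
    rw [exp_eq_cfc (isSymm_cfc _ _), ← cfc_comp' Real.exp _ P
      ((Matrix.finite_real_spectrum.image _).continuousOn _) (continuousOn_spectrum _ _)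
      (isSelfAdjoint_of_isSymm hPs),
      ← h (fun x => x + δ) (fun _ => 1), cfc_one_fun hPs, mul_one]
    congr 1
    refine cfc_congr fun x hx => Real.exp_log ?_
    have := nonneg_of_mem_spectrum hP hx
    positivity
  have e2 : traceMulLog P = ∑ i, ∑ j, w i j * (p i * Real.log (p i) * 1) := by
    rw [traceMulLog, self_mul_mlog hPs, ← h (fun x => x * Real.log x) (fun _ => 1),
      cfc_one_fun hPs, mul_one]
  have e3 : P.trace = ∑ i, ∑ j, w i j * (p i * 1) := by
    rw [← h (fun x => x) (fun _ => 1), cfc_one_fun hPs, mul_one, cfc_id_fun hPs]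
  have e4 : (P * cfc (fun x => Real.log (x + δ)) P).trace
      = ∑ i, ∑ j, w i j * (p i * Real.log (p i + δ) * 1) := by
    rw [← h (fun x => x * Real.log (x + δ)) (fun _ => 1), cfc_one_fun hPs, mul_one, ← cfc_mul_cfc,
      cfc_id_fun hPs]
  have e5 : (d : ℝ) = ∑ i, ∑ j, w i j * (1 * 1) := by
    rw [← h (fun _ => 1) (fun _ => 1), cfc_one_fun hPs, mul_one, Matrix.trace_one]
    simp
  have key : traceMulLog P - d * δ ≤ (P * cfc (fun x => Real.log (x + δ)) P).trace + P.trace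
      - (NormedSpace.exp (cfc (fun x => Real.log (x + δ)) P)).trace := by
    rw [e1, e2, e3, e4, e5]
    simp only [Finset.sum_mul, ← Finset.sum_add_distrib, ← Finset.sum_sub_distrib]
    refine Finset.sum_le_sum fun i _ => Finset.sum_le_sum fun j _ => ?_
    have hpi := nonneg_of_mem_spectrum hP (hp i)
    have : p i * Real.log (p i) ≤ p i * Real.log (p i + δ) := by
      rcases hpi.eq_or_lt with h0 | h0
      · simp [← h0]
      · exact mul_le_mul_of_nonneg_left (Real.log_le_log h0 (by linarith)) hpi
    have := mul_le_mul_of_nonneg_left this (hw i j)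
    linarith
  have : d * δ < η := by
    rw [hδ, mul_div_assoc', div_lt_iff₀ (by positivity)]
    linarith
  linarith

lemma continuous_trace_mul (B : Mat d) : Continuous fun P : Mat d => (P * B).trace :=
  (continuous_id.matrix_mul continuous_const).matrix_trace

/-- Lower semicontinuity of the trace of `P log P` on the positive semidefinite cone. -/
lemma eventually_lt_traceMulLog {ι : Type*} {l : Filter ι} {X : ι → Mat d} {P : Mat d}
    (hX : ∀ n, (X n).PosSemidef) (hP : P.PosSemidef) (h : Filter.Tendsto X l (𝓝 P)) {η : ℝ}
    (hη : 0 < η) : ∀ᶠ n in l, traceMulLog P - η < traceMulLog (X n) := by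
  obtain ⟨B, hB, hlt⟩ := exists_lt_affine hP hη
  have hc : Continuous fun P : Mat d => (P * B).trace + P.trace - (NormedSpace.exp B).trace :=
    ((continuous_trace_mul B).add continuous_id.matrix_trace).sub continuous_const
  -- The affine function given by `B` is nearly exact at `P`, continuous, and by Klein's inequality
  -- a minorant of `traceMulLog` at every `X n`.
  filter_upwards [((hc.tendsto P).comp h).eventually (lt_mem_nhds hlt)] with n hn
  have := klein_nonneg (hX n) hB
  simp only [Function.comp] at hn
  linarith

end

/-! ### The matrices `exp (P + log Q)` for singular `Q`. -/

section

variable {d : ℕ}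

/-- Only the constant term of the exponential series survives multiplication by `Y`. -/
lemma exp_mul_of_mul_eq_zero {X Y : Mat d} (h : X * Y = 0) : NormedSpace.exp X * Y = Y := by
  open scoped Matrix.Norms.L2Operator in
  have h1 := (NormedSpace.exp_series_hasSum_exp' (𝕂 := ℝ) X).mul_right Y
  have h2 : HasSum (fun n : ℕ => ((n.factorial : ℝ)⁻¹ • X ^ n) * Y) Y := by
    convert hasSum_single (f := fun n : ℕ => ((n.factorial : ℝ)⁻¹ • X ^ n) * Y) 0 ?_ using 1
    · simp
    · intro n hn
      obtain ⟨k, rfl⟩ := Nat.exists_eq_succ_of_ne_zero hn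
      simp [pow_succ, mul_assoc, h]
  exact h1.unique h2

lemma isSymm_rangeProj (Q : Mat d) : (rangeProj Q).IsSymm := isSymm_cfc _ _

lemma isSymm_mlog (Q : Mat d) : (mlog Q).IsSymm := isSymm_cfc _ _

lemma rangeProj_mul_self (Q : Mat d) : rangeProj Q * rangeProj Q = rangeProj Q := by
  rw [rangeProj, cfc_mul_cfc]
  congr 1
  ext x
  split_ifs <;> simp

lemma mlog_mul_rangeProj (Q : Mat d) : mlog Q * rangeProj Q = mlog Q := by
  rw [rangeProj, mlog, cfc_mul_cfc]
  congr 1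
  ext x
  split_ifs with h <;> simp [h]

lemma rangeProj_mul_mlog (Q : Mat d) : rangeProj Q * mlog Q = mlog Q := by
  rw [rangeProj, mlog, cfc_mul_cfc]
  congr 1
  ext x
  split_ifs with h <;> simp [h]

lemma self_mul_rangeProj {Q : Mat d} (hQ : Q.IsSymm) : Q * rangeProj Q = Q := by
  rw [rangeProj]
  nth_rewrite 1 [← cfc_id_fun hQ]
  rw [cfc_mul_cfc]
  conv_rhs => rw [← cfc_id_fun hQ]
  congr 1
  ext x
  split_ifs with h <;> simp [h]

lemma exists_mul_eq_rangeProj {Q : Mat d} (hQ : Q.IsSymm) : ∃ Y : Mat d, Y * Q = rangeProj Q := by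
  -- Because `0⁻¹ = 0`, this is the pseudo-inverse of `Q`.
  refine ⟨cfc (fun x : ℝ => x⁻¹) Q, ?_⟩
  nth_rewrite 2 [← cfc_id_fun hQ]
  rw [cfc_mul_cfc, rangeProj]
  congr 1
  ext x
  split_ifs with h <;> simp [h]

lemma rangeProj_of_posDef {Q : Mat d} (hQ : Q.PosDef) : rangeProj Q = 1 := by
  rw [rangeProj, ← cfc_one_fun (isSymm_of_posSemidef hQ.posSemidef)]
  refine cfc_congr fun x hx => if_neg ?_
  rintro rfl
  exact spectrum.zero_notMem ℝ hQ.isUnit hx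

/-- The columns of `1 - rangeProj Q` lie in the kernel of `Q`, and `rangeProj Q` is a left multiple
of `Q`. The algebraic form of the kernel condition is an equation, hence passes to limits. -/
lemma ker_le_ker_iff {P Q : Mat d} (hQ : Q.IsSymm) :
    (∀ x : Fin d → ℝ, Q.mulVec x = 0 → P.mulVec x = 0) ↔ P * rangeProj Q = P := by
  constructor
  · intro h
    have h1 : P * (1 - rangeProj Q) = 0 := by
      refine Matrix.ext_of_mulVec_single fun i => ?_
      rw [← Matrix.mulVec_mulVec, Matrix.zero_mulVec]
      apply h
      rw [Matrix.mulVec_mulVec, mul_sub, mul_one, self_mul_rangeProj hQ, sub_self,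
        Matrix.zero_mulVec]
    rw [mul_sub, mul_one, sub_eq_zero] at h1
    exact h1.symm
  · intro h x hx
    obtain ⟨Y, hY⟩ := exists_mul_eq_rangeProj hQ
    rw [← h, ← hY, ← Matrix.mulVec_mulVec, ← Matrix.mulVec_mulVec, hx]
    simp

/-- The exponent in `expAddLog`. -/
noncomputable def expoAddLog (P Q : Mat d) : Mat d := rangeProj Q * P * rangeProj Q + mlog Q

lemma expAddLog_eq (P Q : Mat d) :
    expAddLog P Q = NormedSpace.exp (expoAddLog P Q) * rangeProj Q := rfl

lemma isSymm_expoAddLog {P : Mat d} (hP : P.IsSymm) (Q : Mat d) : (expoAddLog P Q).IsSymm := by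
  refine Matrix.IsSymm.add ?_ (isSymm_mlog Q)
  rw [Matrix.IsSymm, Matrix.transpose_mul, Matrix.transpose_mul, isSymm_rangeProj, hP, mul_assoc]

lemma expoAddLog_mul_rangeProj (P Q : Mat d) : expoAddLog P Q * rangeProj Q = expoAddLog P Q := by
  rw [expoAddLog, add_mul, mlog_mul_rangeProj, mul_assoc _ (rangeProj Q), rangeProj_mul_self]

lemma rangeProj_mul_expoAddLog (P Q : Mat d) : rangeProj Q * expoAddLog P Q = expoAddLog P Q := by
  rw [expoAddLog, mul_add, rangeProj_mul_mlog, ← mul_assoc, ← mul_assoc, rangeProj_mul_self]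

/-- The exponent vanishes on the kernel of `Q`, so its exponential is the identity there. -/
lemma exp_expoAddLog (P Q : Mat d) :
    NormedSpace.exp (expoAddLog P Q) = expAddLog P Q + (1 - rangeProj Q) := by
  have h := exp_mul_of_mul_eq_zero (X := expoAddLog P Q) (Y := 1 - rangeProj Q)
    (by rw [mul_sub, mul_one, expoAddLog_mul_rangeProj, sub_self])
  rw [expAddLog_eq, ← h, mul_sub, mul_one]
  abel

lemma expAddLog_mul_rangeProj (P Q : Mat d) : expAddLog P Q * rangeProj Q = expAddLog P Q := by
  rw [expAddLog_eq, mul_assoc, rangeProj_mul_self]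

lemma isSymm_expAddLog {P : Mat d} (hP : P.IsSymm) (Q : Mat d) : (expAddLog P Q).IsSymm := by
  have h := exp_expoAddLog P Q
  rw [← sub_eq_iff_eq_add] at h
  rw [← h]
  exact (isSymm_exp (isSymm_expoAddLog hP Q)).sub (Matrix.isSymm_one.sub (isSymm_rangeProj Q))

lemma rangeProj_mul_expAddLog {P : Mat d} (hP : P.IsSymm) (Q : Mat d) :
    rangeProj Q * expAddLog P Q = expAddLog P Q := by
  have h := congrArg Matrix.transpose (expAddLog_mul_rangeProj P Q)
  rwa [Matrix.transpose_mul, isSymm_expAddLog hP, isSymm_rangeProj] at h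

lemma posSemidef_expAddLog {P : Mat d} (hP : P.IsSymm) (Q : Mat d) :
    (expAddLog P Q).PosSemidef := by
  have h := (posSemidef_exp (isSymm_expoAddLog hP Q)).conjTranspose_mul_mul_same (rangeProj Q)
  rwa [Matrix.conjTranspose_eq_transpose_of_trivial, isSymm_rangeProj, mul_assoc, ← expAddLog_eq,
    rangeProj_mul_expAddLog hP] at h

lemma continuous_expAddLog (Q : Mat d) : Continuous fun P => expAddLog P Q := by
  unfold expAddLog
  refine (continuous_exp.comp ?_).matrix_mul continuous_const
  exact ((continuous_const.matrix_mul continuous_id).matrix_mul continuous_const).add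
    continuous_const

/-- `expAddLog P Q` is a subgradient of its trace at `P`. -/
lemma trace_expAddLog_subgradient {P P' : Mat d} (hP : P.IsSymm) (hP' : P'.IsSymm) (Q : Mat d) :
    (expAddLog P Q * (P' - P)).trace ≤ (expAddLog P' Q).trace - (expAddLog P Q).trace := by
  have h := trace_exp_subgradient (isSymm_expoAddLog hP Q) (isSymm_expoAddLog hP' Q)
  have e : expoAddLog P' Q - expoAddLog P Q = rangeProj Q * (P' - P) * rangeProj Q := by
    simp only [expoAddLog, mul_sub, sub_mul]
    abel
  rw [e, ← mul_assoc, ← mul_assoc, Matrix.trace_mul_comm, ← mul_assoc, ← expAddLog_eq,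
    rangeProj_mul_expAddLog hP, exp_expoAddLog, exp_expoAddLog, Matrix.trace_add,
    Matrix.trace_add] at h
  linarith

/-- Perturbation of the exponent of `expAddLog P Q` on the kernel of `Q`. -/
lemma exp_expoAddLog_sub (P Q : Mat d) (hQ : Q.IsSymm) (s : ℝ) :
    NormedSpace.exp (expoAddLog P Q - s • (1 - rangeProj Q))
      = expAddLog P Q + Real.exp (-s) • (1 - rangeProj Q) := by
  have h0 : expoAddLog P Q * (1 - rangeProj Q) = 0 := by
    rw [mul_sub, mul_one, expoAddLog_mul_rangeProj, sub_self]
  have h0' : (1 - rangeProj Q) * expoAddLog P Q = 0 := by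
    rw [sub_mul, one_mul, rangeProj_mul_expoAddLog, sub_self]
  -- The exponent is a multiple of a projection, and functional calculus in `Q` evaluates its
  -- exponential.
  have h1 : NormedSpace.exp (-s • (1 - rangeProj Q))
      = rangeProj Q + Real.exp (-s) • (1 - rangeProj Q) := by
    have e1 : -s • (1 - rangeProj Q) = cfc (fun x : ℝ => -s * (1 - if x = 0 then 0 else 1)) Q := by
      rw [cfc_const_mul _ _ _ (continuousOn_spectrum _ _),
        cfc_sub _ _ _ (continuousOn_spectrum _ _) (continuousOn_spectrum _ _), cfc_one_fun hQ]
      rfl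
    have e2 : rangeProj Q + Real.exp (-s) • (1 - rangeProj Q)
        = cfc (fun x : ℝ => (if x = 0 then 0 else 1)
            + Real.exp (-s) * (1 - if x = 0 then 0 else 1)) Q := by
      rw [cfc_add _ _ _ (continuousOn_spectrum _ _) (continuousOn_spectrum _ _),
        cfc_const_mul _ _ _ (continuousOn_spectrum _ _),
        cfc_sub _ _ _ (continuousOn_spectrum _ _) (continuousOn_spectrum _ _), cfc_one_fun hQ]
      rfl
    rw [e2, exp_eq_cfc (by rw [e1]; exact isSymm_cfc _ _), e1, ← cfc_comp' Real.exp _ Q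
      ((Matrix.finite_real_spectrum.image _).continuousOn _) (continuousOn_spectrum _ _)
      (isSelfAdjoint_of_isSymm hQ)]
    congr 1
    ext x
    split_ifs <;> simp
  have hcomm : Commute (expoAddLog P Q) (-s • (1 - rangeProj Q)) := by
    rw [Commute, SemiconjBy, Matrix.mul_smul, Matrix.smul_mul, h0, h0']
  rw [sub_eq_add_neg, ← neg_smul, Matrix.exp_add_of_commute _ _ hcomm, h1, mul_add, ← expAddLog_eq,
    Matrix.mul_smul, exp_mul_of_mul_eq_zero h0]

lemma isSymm_expoAddLog_sub {P : Mat d} (hP : P.IsSymm) (Q : Mat d) (s : ℝ) :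
    (expoAddLog P Q - s • (1 - rangeProj Q)).IsSymm :=
  (isSymm_expoAddLog hP Q).sub ((Matrix.isSymm_one.sub (isSymm_rangeProj Q)).smul s)

/-- Nonnegativity of the relative entropy with respect to `expAddLog u Q`. -/
lemma klein_expAddLog {P Q u : Mat d} (hP : P.PosSemidef) (hQ : Q.IsSymm) (hu : u.IsSymm)
    (hPQ : P * rangeProj Q = P) :
    0 ≤ traceMulLog P - (P * mlog Q).trace - (P * u).trace - P.trace + (expAddLog u Q).trace := by
  have hRP : rangeProj Q * P = P := by
    have h := congrArg Matrix.transpose hPQ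
    rwa [Matrix.transpose_mul, isSymm_rangeProj, isSymm_of_posSemidef hP] at h
  -- `P` lives on the range of `Q`, so the pairing does not see the perturbation on the kernel.
  have e (s : ℝ) : (P * (expoAddLog u Q - s • (1 - rangeProj Q))).trace
      = (P * mlog Q).trace + (P * u).trace := by
    have h1 : P * (1 - rangeProj Q) = 0 := by rw [mul_sub, mul_one, hPQ, sub_self]
    rw [mul_sub, Matrix.mul_smul, h1, smul_zero, sub_zero, expoAddLog, mul_add, Matrix.trace_add,
      ← mul_assoc, ← mul_assoc, hPQ, Matrix.trace_mul_comm, ← mul_assoc, hRP, add_comm]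
  -- `expAddLog u Q` need not be an exponential, but it is the limit of genuine ones as `s → ∞`.
  -- Klein's inequality applies for each `s`, and the extra term decays like `exp (-s)`.
  have hlim : Filter.Tendsto (fun s : ℝ => traceMulLog P - (P * mlog Q).trace - (P * u).trace
      - P.trace + (expAddLog u Q).trace + Real.exp (-s) * (1 - rangeProj Q).trace) Filter.atTop
      (𝓝 (traceMulLog P - (P * mlog Q).trace - (P * u).trace
      - P.trace + (expAddLog u Q).trace + 0 * (1 - rangeProj Q).trace)) :=
    tendsto_const_nhds.add ((Real.tendsto_exp_neg_atTop_nhds_zero).mul_const _)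
  rw [zero_mul, add_zero] at hlim
  refine ge_of_tendsto' hlim fun s => ?_
  have h := klein_nonneg hP (isSymm_expoAddLog_sub hu Q s)
  rw [exp_expoAddLog_sub u Q hQ, Matrix.trace_add, Matrix.trace_smul, smul_eq_mul, e s] at h
  linarith

/-- The perturbed matrices `E + exp (-s) R'` are exponentials with known logarithm, so their entropy
is explicit. As `s → ∞`, lower semicontinuity gives this one-sided bound, the direction needed to
bound the primal by the dual. -/
lemma traceMulLog_expAddLog_le {Q u : Mat d} (hQ : Q.IsSymm) (hu : u.IsSymm) :
    traceMulLog (expAddLog u Q) ≤ (expAddLog u Q * u).trace + (expAddLog u Q * mlog Q).trace := by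
  set E := expAddLog u Q
  set R' := 1 - rangeProj Q
  have hER : E * R' = 0 := by
    rw [mul_sub, mul_one, expAddLog_mul_rangeProj, sub_self]
  have hRA : R' * expoAddLog u Q = 0 := by
    rw [sub_mul, one_mul, rangeProj_mul_expoAddLog, sub_self]
  have hRR : R' * R' = R' := by
    simp only [R', mul_sub, sub_mul, one_mul, mul_one, rangeProj_mul_self]
    abel
  have hEA : (E * expoAddLog u Q).trace = (E * u).trace + (E * mlog Q).trace := by
    rw [expoAddLog, mul_add, Matrix.trace_add, ← mul_assoc, ← mul_assoc, expAddLog_mul_rangeProj,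
      Matrix.trace_mul_comm, ← mul_assoc, rangeProj_mul_expAddLog hu]
  have hS (s : ℝ) : traceMulLog (E + Real.exp (-s) • R')
      = (E * u).trace + (E * mlog Q).trace - (s * Real.exp (-s)) * R'.trace := by
    rw [← exp_expoAddLog_sub u Q hQ, traceMulLog_exp (isSymm_expoAddLog_sub hu Q s),
      exp_expoAddLog_sub u Q hQ, ← hEA]
    change ((E + Real.exp (-s) • R') * (expoAddLog u Q - s • R')).trace = _
    simp only [add_mul, mul_sub, Matrix.mul_smul, Matrix.smul_mul, hER, hRA, hRR,
      Matrix.trace_add, Matrix.trace_sub, Matrix.trace_smul, smul_zero, Matrix.trace_zero,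
      smul_eq_mul]
    ring
  have hlim : Filter.Tendsto (fun s : ℝ => E + Real.exp (-s) • R') Filter.atTop (𝓝 E) := by
    have : Filter.Tendsto (fun s : ℝ => E + Real.exp (-s) • R') Filter.atTop
        (𝓝 (E + (0 : ℝ) • R')) :=
      tendsto_const_nhds.add ((Real.tendsto_exp_neg_atTop_nhds_zero).smul_const _)
    rwa [zero_smul, add_zero] at this
  refine le_of_forall_pos_lt_add fun η hη => ?_
  have hev := eventually_lt_traceMulLog (X := fun s : ℝ => E + Real.exp (-s) • R')
    (fun s => by
      rw [← exp_expoAddLog_sub u Q hQ]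
      exact posSemidef_exp (isSymm_expoAddLog_sub hu Q s)) (posSemidef_expAddLog hu Q) hlim hη
  have hnn : 0 ≤ R'.trace := by
    have hsymm : R'.IsSymm := Matrix.isSymm_one.sub (isSymm_rangeProj Q)
    rw [← hRR]
    exact trace_mul_self_nonneg hsymm
  -- With `s ≥ 0` the term `-s exp (-s) tr R'` is nonpositive and can be dropped.
  obtain ⟨s, hs, hs0⟩ := (hev.and (Filter.eventually_ge_atTop 0)).exists
  simp only [hS] at hs
  have : 0 ≤ s * Real.exp (-s) * R'.trace := by positivity
  linarith

end

/-! ### Primal and dual objectives: finiteness, weak duality, concavity. -/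

section

variable {d : ℕ}

lemma isSymm_kern {I J : Type*} {c : I → J → Mat d} {ρ₁ ρ₂ ε : ℝ} {u : I → Mat d}
    {v : J → Mat d} (hc : ∀ i j, (c i j).IsSymm)
    (hu : ∀ i, (u i).IsSymm) (hv : ∀ j, (v j).IsSymm) (i : I) (j : J) :
    (kern c ρ₁ ρ₂ ε u v i j).IsSymm :=
  ((((hc i j).add ((hu i).smul ρ₁)).add ((hv j).smul ρ₂)).smul _).neg

/-- This turns the linear term of Klein's inequality at `B = K` into the transport cost and the
pairings with the potentials. -/
lemma trace_mul_kern {I J : Type*} {c : I → J → Mat d} {ρ₁ ρ₂ ε : ℝ} (hε : ε ≠ 0)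
    (u : I → Mat d) (v : J → Mat d) (X : Mat d) (i : I) (j : J) :
    ε * (X * kern c ρ₁ ρ₂ ε u v i j).trace
      = -((X * c i j).trace + ρ₁ * (X * u i).trace + ρ₂ * (X * v j).trace) := by
  simp only [kern, mul_neg, Matrix.mul_smul, mul_add, Matrix.trace_neg, Matrix.trace_smul,
    Matrix.trace_add, smul_eq_mul]
  field_simp

variable {I J : Type*} [Fintype I] [Fintype J]

/-- The finite values of the relative entropy. -/
noncomputable def relEntropy (P Q : Mat d) : ℝ :=
  traceMulLog P - (P * mlog Q).trace - P.trace + Q.trace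

/-- The couplings at which the primal objective is finite. -/
structure Feasible (μ : I → Mat d) (ν : J → Mat d) (γ : I → J → Mat d) : Prop where
  posSemidef : ∀ i j, (γ i j).PosSemidef
  left : ∀ i, (∑ j, γ i j) * rangeProj (μ i) = ∑ j, γ i j
  right : ∀ j, (∑ i, γ i j) * rangeProj (ν j) = ∑ i, γ i j

/-- The primal objective as a function of the coupling and of its two marginals. -/
noncomputable def primalAux (c : I → J → Mat d) (μ : I → Mat d) (ν : J → Mat d) (ρ₁ ρ₂ ε : ℝ)
    (γ : I → J → Mat d) (P : I → Mat d) (Q : J → Mat d) : ℝ :=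
  ∑ i, ∑ j, (γ i j * (c i j).transpose).trace + ρ₁ * ∑ i, relEntropy (P i) (μ i)
    + ρ₂ * ∑ j, relEntropy (Q j) (ν j) + ε * ∑ i, ∑ j, (traceMulLog (γ i j) - (γ i j).trace)

/-- The finite values of the primal objective. -/
noncomputable def primalReal (c : I → J → Mat d) (μ : I → Mat d) (ν : J → Mat d) (ρ₁ ρ₂ ε : ℝ)
    (γ : I → J → Mat d) : ℝ :=
  primalAux c μ ν ρ₁ ρ₂ ε γ (fun i => ∑ j, γ i j) (fun j => ∑ i, γ i j)

lemma ereal_coe_sum {ι : Type*} (s : Finset ι) (f : ι → ℝ) :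
    ((∑ i ∈ s, f i : ℝ) : EReal) = ∑ i ∈ s, (f i : EReal) :=
  map_sum (⟨⟨Real.toEReal, EReal.coe_zero⟩, EReal.coe_add⟩ : ℝ →+ EReal) f s

lemma ereal_add_ne_bot {x y : EReal} (hx : x ≠ ⊥) (hy : y ≠ ⊥) : x + y ≠ ⊥ :=
  EReal.add_ne_bot_iff.2 ⟨hx, hy⟩

lemma ereal_sum_ne_bot {ι : Type*} (s : Finset ι) {f : ι → EReal} (hf : ∀ i ∈ s, f i ≠ ⊥) :
    ∑ i ∈ s, f i ≠ ⊥ :=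
  Finset.sum_induction f (· ≠ ⊥) (fun _ _ ha hb => ereal_add_ne_bot ha hb) EReal.zero_ne_bot hf

lemma ereal_sum_eq_top {ι : Type*} [Fintype ι] {f : ι → EReal} (hf : ∀ i, f i ≠ ⊥) {i : ι}
    (hi : f i = ⊤) : ∑ i, f i = ⊤ := by
  classical
  rw [← Finset.add_sum_erase _ f (Finset.mem_univ i), hi]
  exact EReal.top_add_of_ne_bot (ereal_sum_ne_bot _ fun _ _ => hf _)

lemma ereal_sum_eq_bot {ι : Type*} [Fintype ι] {f : ι → EReal} {i : ι}
    (hi : f i = ⊥) : ∑ i, f i = ⊥ := by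
  classical
  rw [← Finset.add_sum_erase _ f (Finset.mem_univ i), hi, EReal.bot_add]

lemma KL_eq {P Q : Mat d} (hP : P.PosSemidef) (hQ : Q.IsSymm) (hPQ : P * rangeProj Q = P) :
    KL P Q = (relEntropy P Q : ℝ) := by
  rw [KL, if_pos ⟨hP, (ker_le_ker_iff hQ).2 hPQ⟩, relEntropy, traceMulLog]
  simp only [Matrix.trace_add, Matrix.trace_sub]

lemma KL_ne_bot (P Q : Mat d) : KL P Q ≠ ⊥ := by
  unfold KL
  split_ifs
  · exact EReal.coe_ne_bot _
  · exact top_ne_bot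

lemma KL_eq_top {P Q : Mat d} (hQ : Q.IsSymm) (hPQ : P * rangeProj Q ≠ P) : KL P Q = ⊤ :=
  if_neg fun h => hPQ ((ker_le_ker_iff hQ).1 h.2)

lemma entropy_ne_top (P : Mat d) : entropy P ≠ ⊤ := by
  unfold entropy
  split_ifs
  · exact EReal.coe_ne_top _
  · exact bot_ne_top

lemma posSemidef_sum {ι : Type*} [Fintype ι] {f : ι → Mat d} (hf : ∀ i, (f i).PosSemidef) :
    (∑ i, f i).PosSemidef :=
  Finset.sum_induction f _ (fun _ _ ha hb => ha.add hb) Matrix.PosSemidef.zero fun i _ => hf i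

variable {c : I → J → Mat d} {μ : I → Mat d} {ν : J → Mat d} {ρ₁ ρ₂ ε : ℝ}

lemma primal_eq {γ : I → J → Mat d} (hμ : ∀ i, (μ i).IsSymm) (hν : ∀ j, (ν j).IsSymm)
    (hγ : Feasible μ ν γ) : primal c μ ν ρ₁ ρ₂ ε γ = (primalReal c μ ν ρ₁ ρ₂ ε γ : ℝ) := by
  have h1 (i : I) : KL (∑ j, γ i j) (μ i) = (relEntropy (∑ j, γ i j) (μ i) : ℝ) :=
    KL_eq (posSemidef_sum (hγ.posSemidef i)) (hμ i) (hγ.left i)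
  have h2 (j : J) : KL (∑ i, γ i j) (ν j) = (relEntropy (∑ i, γ i j) (ν j) : ℝ) :=
    KL_eq (posSemidef_sum fun i => hγ.posSemidef i j) (hν j) (hγ.right j)
  have h3 (i : I) (j : J) : entropy (γ i j) = (-(traceMulLog (γ i j) - (γ i j).trace) : ℝ) := by
    rw [entropy, if_pos (hγ.posSemidef i j), Matrix.trace_sub, traceMulLog]
  simp only [primal, h1, h2, h3, ← ereal_coe_sum, ← EReal.coe_mul, ← EReal.coe_add,
    ← EReal.coe_sub, primalReal, primalAux]
  congr 1
  simp only [Finset.sum_neg_distrib]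
  ring

/-- Each violated feasibility condition makes one summand infinite. Since `⊤ + ⊥ = ⊥` in `EReal`,
the other summands must first be shown to differ from `⊥`. -/
lemma primal_eq_top {γ : I → J → Mat d} (hμ : ∀ i, (μ i).IsSymm) (hν : ∀ j, (ν j).IsSymm)
    (hρ₁ : 0 < ρ₁) (hρ₂ : 0 < ρ₂) (hε : 0 < ε) (hγ : ¬ Feasible μ ν γ) :
    primal c μ ν ρ₁ ρ₂ ε γ = ⊤ := by
  have mul_ne_bot {r : ℝ} (hr : 0 < r) {x : EReal} (hx : x ≠ ⊥) : (r : EReal) * x ≠ ⊥ := by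
    induction x with
    | bot => exact absurd rfl hx
    | coe x => rw [← EReal.coe_mul]; exact EReal.coe_ne_bot _
    | top => rw [EReal.coe_mul_top_of_pos hr]; exact top_ne_bot
  have hb1 : (ρ₁ : EReal) * ∑ i, KL (∑ j, γ i j) (μ i) ≠ ⊥ :=
    mul_ne_bot hρ₁ (ereal_sum_ne_bot _ fun _ _ => KL_ne_bot _ _)
  have hb2 : (ρ₂ : EReal) * ∑ j, KL (∑ i, γ i j) (ν j) ≠ ⊥ :=
    mul_ne_bot hρ₂ (ereal_sum_ne_bot _ fun _ _ => KL_ne_bot _ _)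
  have hb3 : -((ε : EReal) * ∑ i, ∑ j, entropy (γ i j)) ≠ ⊥ := by
    rw [← mul_neg]
    refine mul_ne_bot hε ?_
    rw [Ne, EReal.neg_eq_bot_iff]
    refine Finset.sum_induction _ (· ≠ ⊤) (fun _ _ ha hb => EReal.add_ne_top ha hb)
      EReal.zero_ne_top fun i _ => ?_
    exact Finset.sum_induction _ (· ≠ ⊤) (fun _ _ ha hb => EReal.add_ne_top ha hb)
      EReal.zero_ne_top fun j _ => entropy_ne_top _
  have hc0 := EReal.coe_ne_bot (∑ i, ∑ j, (γ i j * (c i j).transpose).trace)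
  rw [primal, sub_eq_add_neg]
  by_cases h1 : ∀ i j, (γ i j).PosSemidef
  · by_cases h2 : ∀ i, (∑ j, γ i j) * rangeProj (μ i) = ∑ j, γ i j
    · have h3 : ¬ ∀ j, (∑ i, γ i j) * rangeProj (ν j) = ∑ i, γ i j := fun h3 => hγ ⟨h1, h2, h3⟩
      push Not at h3
      obtain ⟨j, hj⟩ := h3
      rw [ereal_sum_eq_top (f := fun j => KL (∑ i, γ i j) (ν j)) (fun _ => KL_ne_bot _ _)
          (KL_eq_top (hν j) hj),
        EReal.coe_mul_top_of_pos hρ₂, EReal.add_top_of_ne_bot (ereal_add_ne_bot hc0 hb1),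
        EReal.top_add_of_ne_bot hb3]
    · push Not at h2
      obtain ⟨i, hi⟩ := h2
      rw [ereal_sum_eq_top (f := fun i => KL (∑ j, γ i j) (μ i)) (fun _ => KL_ne_bot _ _)
          (KL_eq_top (hμ i) hi),
        EReal.coe_mul_top_of_pos hρ₁, EReal.add_top_of_ne_bot hc0, EReal.top_add_of_ne_bot hb2,
        EReal.top_add_of_ne_bot hb3]
  · push Not at h1
    obtain ⟨i, j, hij⟩ := h1
    have hbot : ∑ i, ∑ j, entropy (γ i j) = ⊥ :=
      ereal_sum_eq_bot (i := i) (ereal_sum_eq_bot (i := j) (if_neg hij))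
    rw [hbot, EReal.coe_mul_bot_of_pos hε, EReal.neg_bot]
    exact EReal.add_top_of_ne_bot (ereal_add_ne_bot (ereal_add_ne_bot hc0 hb1) hb2)

lemma dual_eq (u : I → Mat d) (v : J → Mat d) :
    dual c μ ν ρ₁ ρ₂ ε u v
      = -(ρ₁ * (∑ i, (expAddLog (u i) (μ i)).trace - ∑ i, (μ i).trace)
        + ρ₂ * (∑ j, (expAddLog (v j) (ν j)).trace - ∑ j, (ν j).trace)
        + ε * ∑ i, ∑ j, (NormedSpace.exp (kern c ρ₁ ρ₂ ε u v i j)).trace) := by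
  simp only [dual, Matrix.trace_add, Matrix.trace_smul, Matrix.trace_sum, Matrix.trace_sub,
    Finset.sum_sub_distrib, smul_eq_mul]

/-- Weak duality, with a lower bound for the duality gap. -/
lemma dual_add_le_primalReal (hc : ∀ i j, (c i j).IsSymm) (hμ : ∀ i, (μ i).IsSymm)
    (hν : ∀ j, (ν j).IsSymm) (hρ₁ : 0 < ρ₁) (hρ₂ : 0 < ρ₂) (hε : 0 < ε) {γ : I → J → Mat d}
    (hγ : Feasible μ ν γ) {u : I → Mat d} {v : J → Mat d} (hu : ∀ i, (u i).IsSymm)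
    (hv : ∀ j, (v j).IsSymm) :
    dual c μ ν ρ₁ ρ₂ ε u v + ε * ∑ i, ∑ j,
        ((msqrt (γ i j) - halfExp (kern c ρ₁ ρ₂ ε u v i j))
          * (msqrt (γ i j) - halfExp (kern c ρ₁ ρ₂ ε u v i j))).trace
      ≤ primalReal c μ ν ρ₁ ρ₂ ε γ := by
  have h1 : 0 ≤ ρ₁ * ∑ i, (relEntropy (∑ j, γ i j) (μ i) - ∑ j, (γ i j * u i).trace
      - (μ i).trace + (expAddLog (u i) (μ i)).trace) := by
    refine mul_nonneg hρ₁.le (Finset.sum_nonneg fun i _ => ?_)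
    have := klein_expAddLog (posSemidef_sum (hγ.posSemidef i)) (hμ i) (hu i) (hγ.left i)
    rw [Finset.sum_mul _ _ (u i), Matrix.trace_sum (f := fun j => γ i j * u i)] at this
    rw [relEntropy]
    linarith
  have h2 : 0 ≤ ρ₂ * ∑ j, (relEntropy (∑ i, γ i j) (ν j) - ∑ i, (γ i j * v j).trace
      - (ν j).trace + (expAddLog (v j) (ν j)).trace) := by
    refine mul_nonneg hρ₂.le (Finset.sum_nonneg fun j _ => ?_)
    have := klein_expAddLog (posSemidef_sum fun i => hγ.posSemidef i j) (hν j) (hv j) (hγ.right j)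
    rw [Finset.sum_mul _ _ (v j), Matrix.trace_sum (f := fun i => γ i j * v j)] at this
    rw [relEntropy]
    linarith
  -- Klein's remainder is kept only for the transport terms; the marginal terms contribute plain
  -- nonnegativity.
  have h3 : ∑ i, ∑ j, ε * ((msqrt (γ i j) - halfExp (kern c ρ₁ ρ₂ ε u v i j))
        * (msqrt (γ i j) - halfExp (kern c ρ₁ ρ₂ ε u v i j))).trace
      ≤ ∑ i, ∑ j, (ε * (traceMulLog (γ i j) - (γ i j).trace)
        + ((γ i j * (c i j).transpose).trace + ρ₁ * (γ i j * u i).trace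
          + ρ₂ * (γ i j * v j).trace)
        + ε * (NormedSpace.exp (kern c ρ₁ ρ₂ ε u v i j)).trace) := by
    refine Finset.sum_le_sum fun i _ => Finset.sum_le_sum fun j _ => ?_
    have hk := mul_le_mul_of_nonneg_left
      (klein (hγ.posSemidef i j) (isSymm_kern (ρ₁ := ρ₁) (ρ₂ := ρ₂) (ε := ε) hc hu hv i j)) hε.le
    have ht := trace_mul_kern (c := c) (ρ₁ := ρ₁) (ρ₂ := ρ₂) hε.ne' u v (γ i j) i j
    rw [(hc i j).eq]
    linarith
  simp only [Finset.sum_add_distrib, Finset.sum_sub_distrib, ← Finset.mul_sum] at h1 h2 h3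
  -- With the summation order aligned, the pairings of `γ` with `u` and `v` cancel between `h1`,
  -- `h2` and `h3`.
  rw [Finset.sum_comm (f := fun j i => (γ i j * v j).trace)] at h2
  rw [dual_eq, primalReal, primalAux]
  simp only [Finset.sum_sub_distrib]
  linarith

/-- Concavity of the dual objective. -/
lemma dual_sub_dual_le (hc : ∀ i j, (c i j).IsSymm) (hρ₁ : 0 < ρ₁) (hρ₂ : 0 < ρ₂) (hε : 0 < ε)
    {u u' : I → Mat d} {v v' : J → Mat d} (hu : ∀ i, (u i).IsSymm) (hv : ∀ j, (v j).IsSymm)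
    (hu' : ∀ i, (u' i).IsSymm) (hv' : ∀ j, (v' j).IsSymm) :
    dual c μ ν ρ₁ ρ₂ ε u' v' - dual c μ ν ρ₁ ρ₂ ε u v
      ≤ ρ₁ * ∑ i, ((∑ j, NormedSpace.exp (kern c ρ₁ ρ₂ ε u v i j) - expAddLog (u i) (μ i))
          * (u' i - u i)).trace
        + ρ₂ * ∑ j, ((∑ i, NormedSpace.exp (kern c ρ₁ ρ₂ ε u v i j) - expAddLog (v j) (ν j))
          * (v' j - v j)).trace := by
  have h1 := mul_le_mul_of_nonneg_left (Finset.sum_le_sum fun i (_ : i ∈ Finset.univ) =>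
    trace_expAddLog_subgradient (hu i) (hu' i) (μ i)) hρ₁.le
  have h2 := mul_le_mul_of_nonneg_left (Finset.sum_le_sum fun j (_ : j ∈ Finset.univ) =>
    trace_expAddLog_subgradient (hv j) (hv' j) (ν j)) hρ₂.le
  have h3 : ∑ i, ∑ j, -(ρ₁ * (NormedSpace.exp (kern c ρ₁ ρ₂ ε u v i j) * (u' i - u i)).trace
        + ρ₂ * (NormedSpace.exp (kern c ρ₁ ρ₂ ε u v i j) * (v' j - v j)).trace)
      ≤ ∑ i, ∑ j, (ε * (NormedSpace.exp (kern c ρ₁ ρ₂ ε u' v' i j)).trace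
        - ε * (NormedSpace.exp (kern c ρ₁ ρ₂ ε u v i j)).trace) := by
    refine Finset.sum_le_sum fun i _ => Finset.sum_le_sum fun j _ => ?_
    have hk := mul_le_mul_of_nonneg_left (trace_exp_subgradient
      (isSymm_kern (ρ₁ := ρ₁) (ρ₂ := ρ₂) (ε := ε) hc hu hv i j)
      (isSymm_kern (ρ₁ := ρ₁) (ρ₂ := ρ₂) (ε := ε) hc hu' hv' i j)) hε.le
    -- The costs cancel in the difference of the two kernels; only the increments of `u` and `v`
    -- remain.
    rw [mul_sub, Matrix.trace_sub, mul_sub ε, trace_mul_kern hε.ne', trace_mul_kern hε.ne'] at hk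
    simp only [mul_sub, Matrix.trace_sub]
    linarith
  simp only [Finset.sum_neg_distrib, Finset.sum_add_distrib, Finset.sum_sub_distrib,
    ← Finset.mul_sum] at h1 h2 h3
  rw [Finset.sum_comm (f := fun i j => (NormedSpace.exp (kern c ρ₁ ρ₂ ε u v i j)
    * (v' j - v j)).trace)] at h3
  simp only [dual_eq, sub_mul (∑ _, _ : Mat d), Matrix.trace_sub, Finset.sum_mul,
    Matrix.trace_sum, Finset.sum_sub_distrib]
  linarith

/-- The primal objective at the triple given by a dual pair, in terms of the dual objective. -/
lemma primalAux_le_dual (hc : ∀ i j, (c i j).IsSymm) (hμ : ∀ i, (μ i).IsSymm)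
    (hν : ∀ j, (ν j).IsSymm) (hρ₁ : 0 < ρ₁) (hρ₂ : 0 < ρ₂) (hε : 0 < ε)
    {u : I → Mat d} {v : J → Mat d} (hu : ∀ i, (u i).IsSymm) (hv : ∀ j, (v j).IsSymm) :
    primalAux c μ ν ρ₁ ρ₂ ε (fun i j => NormedSpace.exp (kern c ρ₁ ρ₂ ε u v i j))
        (fun i => expAddLog (u i) (μ i)) (fun j => expAddLog (v j) (ν j))
      ≤ dual c μ ν ρ₁ ρ₂ ε u v
        - ρ₁ * ∑ i, ((∑ j, NormedSpace.exp (kern c ρ₁ ρ₂ ε u v i j) - expAddLog (u i) (μ i))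
          * u i).trace
        - ρ₂ * ∑ j, ((∑ i, NormedSpace.exp (kern c ρ₁ ρ₂ ε u v i j) - expAddLog (v j) (ν j))
          * v j).trace := by
  have h1 := mul_le_mul_of_nonneg_left (Finset.sum_le_sum fun i (_ : i ∈ Finset.univ) =>
    traceMulLog_expAddLog_le (hμ i) (hu i)) hρ₁.le
  have h2 := mul_le_mul_of_nonneg_left (Finset.sum_le_sum fun j (_ : j ∈ Finset.univ) =>
    traceMulLog_expAddLog_le (hν j) (hv j)) hρ₂.le
  -- The transport terms are exact; the inequality comes from the marginal terms alone.
  have h3 : ∑ i, ∑ j, ε * traceMulLog (NormedSpace.exp (kern c ρ₁ ρ₂ ε u v i j))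
      = ∑ i, ∑ j, -((NormedSpace.exp (kern c ρ₁ ρ₂ ε u v i j) * (c i j).transpose).trace
        + ρ₁ * (NormedSpace.exp (kern c ρ₁ ρ₂ ε u v i j) * u i).trace
        + ρ₂ * (NormedSpace.exp (kern c ρ₁ ρ₂ ε u v i j) * v j).trace) := by
    refine Finset.sum_congr rfl fun i _ => Finset.sum_congr rfl fun j _ => ?_
    rw [traceMulLog_exp (isSymm_kern hc hu hv i j), trace_mul_kern hε.ne', (hc i j).eq]
  simp only [Finset.sum_neg_distrib, Finset.sum_add_distrib, ← Finset.mul_sum] at h1 h2 h3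
  rw [Finset.sum_comm (f := fun i j => (NormedSpace.exp (kern c ρ₁ ρ₂ ε u v i j)
    * v j).trace)] at h3
  simp only [dual_eq, primalAux, relEntropy, sub_mul (∑ _, _ : Mat d), Matrix.trace_sub,
    Finset.sum_mul, Matrix.trace_sum, Finset.sum_sub_distrib, Finset.sum_add_distrib]
  linarith

end

/-! ### Lower limits, compactness, and stationarity for the penalized dual. -/

section

section LowerLimit

variable {ι : Type*} {l : Filter ι}

/-- The real number `a` is at most the lower limit of `x`. -/
def LELiminf (l : Filter ι) (x : ι → ℝ) (a : ℝ) : Prop := ∀ η : ℝ, 0 < η → ∀ᶠ n in l, a - η < x n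

lemma LELiminf.add {x y : ι → ℝ} {a b : ℝ} (hx : LELiminf l x a) (hy : LELiminf l y b) :
    LELiminf l (fun n => x n + y n) (a + b) := fun η hη => by
  filter_upwards [hx (η / 2) (half_pos hη), hy (η / 2) (half_pos hη)] with n h1 h2
  linarith

lemma LELiminf.const_mul {x : ι → ℝ} {a r : ℝ} (hr : 0 < r) (hx : LELiminf l x a) :
    LELiminf l (fun n => r * x n) (r * a) := fun η hη => by
  filter_upwards [hx (η / r) (div_pos hη hr)] with n h
  have := mul_lt_mul_of_pos_left h hr
  rwa [mul_sub, mul_div_cancel₀ _ hr.ne'] at this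

lemma LELiminf.of_tendsto {x : ι → ℝ} {a : ℝ} (hx : Filter.Tendsto x l (𝓝 a)) :
    LELiminf l x a := fun _ hη => hx.eventually (lt_mem_nhds (sub_lt_self a hη))

lemma LELiminf.sum {κ : Type*} (s : Finset κ) {x : κ → ι → ℝ} {a : κ → ℝ}
    (hx : ∀ k, LELiminf l (x k) (a k)) :
    LELiminf l (fun n => ∑ k ∈ s, x k n) (∑ k ∈ s, a k) := by
  classical
  induction s using Finset.induction_on with
  | empty => simpa using LELiminf.of_tendsto (tendsto_const_nhds (x := (0 : ℝ)))
  | insert k s hk ih =>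
    simp only [Finset.sum_insert hk]
    exact (hx k).add ih

end LowerLimit

variable {d : ℕ}

/-- The matrices with entries bounded by `C`. -/
def entryBox (d : ℕ) (C : ℝ) : Set (Mat d) := {A | ∀ a b, A a b ∈ Set.Icc (-C) C}

lemma isCompact_entryBox (C : ℝ) : IsCompact (entryBox d C) := by
  have h : IsCompact (Set.univ.pi fun _ => Set.univ.pi fun _ => Set.Icc (-C) C :
      Set (Fin d → Fin d → ℝ)) :=
    isCompact_univ_pi fun _ => isCompact_univ_pi fun _ => isCompact_Icc
  have e : entryBox d C = (Set.univ.pi fun _ => Set.univ.pi fun _ => Set.Icc (-C) C :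
      Set (Fin d → Fin d → ℝ)) := by
    ext A
    exact ⟨fun h a _ b _ => h a b, fun h a b => h a trivial b trivial⟩
  rw [e]
  exact h

lemma mem_entryBox_of_trace_mul_self_le {A : Mat d} (hA : A.IsSymm) {C : ℝ}
    (h : (A * A).trace ≤ C) : A ∈ entryBox d (√C) := fun a b =>
  abs_le.1 (Real.abs_le_sqrt ((sq_apply_le_trace_mul_self hA a b).trans h))

variable {I J : Type*}

/-- The pairs of families of symmetric matrices. -/
def symmPairs (I J : Type*) (d : ℕ) : Set ((I → Mat d) × (J → Mat d)) :=
  {z | (∀ i, (z.1 i).IsSymm) ∧ ∀ j, (z.2 j).IsSymm}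

lemma isClosed_symmPairs : IsClosed (symmPairs I J d) := by
  refine IsClosed.inter
    (s₁ := {z : (I → Mat d) × (J → Mat d) | ∀ i, (z.1 i).IsSymm})
    (s₂ := {z : (I → Mat d) × (J → Mat d) | ∀ j, (z.2 j).IsSymm}) ?_ ?_
  · simp only [Set.ofPred_forall]
    refine isClosed_iInter fun i => ?_
    have h : Continuous fun z : (I → Mat d) × (J → Mat d) => z.1 i :=
      (continuous_apply i).comp continuous_fst
    exact isClosed_eq h.matrix_transpose h
  · simp only [Set.ofPred_forall]
    refine isClosed_iInter fun j => ?_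
    have h : Continuous fun z : (I → Mat d) × (J → Mat d) => z.2 j :=
      (continuous_apply j).comp continuous_snd
    exact isClosed_eq h.matrix_transpose h

/-- A continuous function with a bounded superlevel set attains its maximum over the pairs of
families of symmetric matrices. -/
lemma exists_max_of_bounded_superlevel {f : (I → Mat d) × (J → Mat d) → ℝ} (hf : Continuous f)
    {C₁ C₂ : ℝ} (hC : ∀ z ∈ symmPairs I J d, f 0 ≤ f z →
      (∀ i, z.1 i ∈ entryBox d C₁) ∧ ∀ j, z.2 j ∈ entryBox d C₂) :
    ∃ z ∈ symmPairs I J d, ∀ z' ∈ symmPairs I J d, f z' ≤ f z := by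
  set K : Set ((I → Mat d) × (J → Mat d)) :=
    symmPairs I J d ∩ ((Set.univ.pi fun _ => entryBox d C₁) ×ˢ (Set.univ.pi fun _ => entryBox d C₂))
  have hK : IsCompact K :=
    ((isCompact_univ_pi fun _ => isCompact_entryBox C₁).prod
      (isCompact_univ_pi fun _ => isCompact_entryBox C₂)).inter_left isClosed_symmPairs
  have hmem {z} (hz : z ∈ symmPairs I J d) (h : f 0 ≤ f z) : z ∈ K :=
    ⟨hz, fun i _ => (hC z hz h).1 i, fun j _ => (hC z hz h).2 j⟩
  have h0 : (0 : (I → Mat d) × (J → Mat d)) ∈ symmPairs I J d :=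
    ⟨fun _ => Matrix.isSymm_zero, fun _ => Matrix.isSymm_zero⟩
  obtain ⟨z, hz, hmax⟩ := hK.exists_isMaxOn ⟨0, hmem h0 le_rfl⟩ hf.continuousOn
  refine ⟨z, hz.1, fun z' hz' => ?_⟩
  by_cases h : f 0 ≤ f z'
  · exact hmax (hmem hz' h)
  · exact (not_le.1 h).le.trans (hmax (hmem h0 le_rfl))

lemma continuous_kern {c : I → J → Mat d} {ρ₁ ρ₂ ε : ℝ} (i : I) (j : J) :
    Continuous fun z : (I → Mat d) × (J → Mat d) => kern c ρ₁ ρ₂ ε z.1 z.2 i j := by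
  unfold kern
  fun_prop

lemma trace_exp_kern_nonneg {c : I → J → Mat d} {ρ₁ ρ₂ ε : ℝ} (hc : ∀ i j, (c i j).IsSymm) {u : I → Mat d} {v : J → Mat d}
    (hu : ∀ i, (u i).IsSymm) (hv : ∀ j, (v j).IsSymm) (i : I) (j : J) :
    0 ≤ (NormedSpace.exp (kern c ρ₁ ρ₂ ε u v i j)).trace :=
  (posSemidef_exp (isSymm_kern hc hu hv i j)).trace_nonneg

lemma symmPairs_add_smul {z w : (I → Mat d) × (J → Mat d)} (hz : z ∈ symmPairs I J d)
    (hw : w ∈ symmPairs I J d) (t : ℝ) : z + t • w ∈ symmPairs I J d :=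
  ⟨fun i => (hz.1 i).add ((hw.1 i).smul t), fun j => (hz.2 j).add ((hw.2 j).smul t)⟩

lemma symmPairs_sub_smul {z w : (I → Mat d) × (J → Mat d)} (hz : z ∈ symmPairs I J d)
    (hw : w ∈ symmPairs I J d) (t : ℝ) : z - t • w ∈ symmPairs I J d :=
  ⟨fun i => (hz.1 i).sub ((hw.1 i).smul t), fun j => (hz.2 j).sub ((hw.2 j).smul t)⟩

variable [Fintype I] [Fintype J] {c : I → J → Mat d} {μ : I → Mat d} {ν : J → Mat d} {ρ₁ ρ₂ ε : ℝ}

lemma continuous_dual :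
    Continuous fun z : (I → Mat d) × (J → Mat d) => dual c μ ν ρ₁ ρ₂ ε z.1 z.2 := by
  simp only [dual_eq]
  have h1 (i : I) : Continuous fun z : (I → Mat d) × (J → Mat d) => expAddLog (z.1 i) (μ i) :=
    (continuous_expAddLog (μ i)).comp ((continuous_apply i).comp continuous_fst)
  have h2 (j : J) : Continuous fun z : (I → Mat d) × (J → Mat d) => expAddLog (z.2 j) (ν j) :=
    (continuous_expAddLog (ν j)).comp ((continuous_apply j).comp continuous_snd)
  have h3 (i : I) (j : J) : Continuous fun z : (I → Mat d) × (J → Mat d) =>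
      NormedSpace.exp (kern c ρ₁ ρ₂ ε z.1 z.2 i j) := continuous_exp.comp (continuous_kern i j)
  refine Continuous.neg (Continuous.add (Continuous.add ?_ ?_) ?_)
  · exact continuous_const.mul
      ((continuous_finsetSum _ fun i _ => (h1 i).matrix_trace).sub continuous_const)
  · exact continuous_const.mul
      ((continuous_finsetSum _ fun j _ => (h2 j).matrix_trace).sub continuous_const)
  · exact continuous_const.mul
      (continuous_finsetSum _ fun i _ => continuous_finsetSum _ fun j _ => (h3 i j).matrix_trace)

/-- The weighted squared norm of a pair of families of matrices. -/
noncomputable def sqNorm (ρ₁ ρ₂ : ℝ) (z : (I → Mat d) × (J → Mat d)) : ℝ :=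
  ρ₁ * ∑ i, (z.1 i * z.1 i).trace + ρ₂ * ∑ j, (z.2 j * z.2 j).trace

lemma continuous_sqNorm : Continuous (sqNorm (I := I) (J := J) (d := d) ρ₁ ρ₂) := by
  unfold sqNorm
  have h1 (i : I) : Continuous fun z : (I → Mat d) × (J → Mat d) => (z.1 i * z.1 i).trace := by
    have h : Continuous fun z : (I → Mat d) × (J → Mat d) => z.1 i := by fun_prop
    exact (h.matrix_mul h).matrix_trace
  have h2 (j : J) : Continuous fun z : (I → Mat d) × (J → Mat d) => (z.2 j * z.2 j).trace := by
    have h : Continuous fun z : (I → Mat d) × (J → Mat d) => z.2 j := by fun_prop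
    exact (h.matrix_mul h).matrix_trace
  fun_prop

lemma sqNorm_nonneg (hρ₁ : 0 < ρ₁) (hρ₂ : 0 < ρ₂) {z : (I → Mat d) × (J → Mat d)}
    (hz : z ∈ symmPairs I J d) : 0 ≤ sqNorm ρ₁ ρ₂ z :=
  add_nonneg (mul_nonneg hρ₁.le (Finset.sum_nonneg fun i _ => trace_mul_self_nonneg (hz.1 i)))
    (mul_nonneg hρ₂.le (Finset.sum_nonneg fun j _ => trace_mul_self_nonneg (hz.2 j)))

lemma trace_mul_self_le_sqNorm (hρ₁ : 0 < ρ₁) (hρ₂ : 0 < ρ₂) {z : (I → Mat d) × (J → Mat d)}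
    (hz : z ∈ symmPairs I J d) :
    (∀ i, (z.1 i * z.1 i).trace ≤ sqNorm ρ₁ ρ₂ z / ρ₁)
      ∧ ∀ j, (z.2 j * z.2 j).trace ≤ sqNorm ρ₁ ρ₂ z / ρ₂ := by
  have h1 (i : I) := trace_mul_self_nonneg (hz.1 i)
  have h2 (j : J) := trace_mul_self_nonneg (hz.2 j)
  have h1s := mul_nonneg hρ₁.le (Finset.sum_nonneg fun i (_ : i ∈ Finset.univ) => h1 i)
  have h2s := mul_nonneg hρ₂.le (Finset.sum_nonneg fun j (_ : j ∈ Finset.univ) => h2 j)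
  constructor
  · intro i
    rw [le_div_iff₀ hρ₁, mul_comm]
    have := mul_le_mul_of_nonneg_left
      (Finset.single_le_sum (fun i _ => h1 i) (Finset.mem_univ i)) hρ₁.le
    simp only [sqNorm]
    linarith
  · intro j
    rw [le_div_iff₀ hρ₂, mul_comm]
    have := mul_le_mul_of_nonneg_left
      (Finset.single_le_sum (fun j _ => h2 j) (Finset.mem_univ j)) hρ₂.le
    simp only [sqNorm]
    linarith

/-- An upper bound for the dual objective. -/
lemma dual_add_trace_le (hρ₁ : 0 < ρ₁) (hρ₂ : 0 < ρ₂) {u : I → Mat d} {v : J → Mat d}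
    (hu : ∀ i, (u i).IsSymm) (hv : ∀ j, (v j).IsSymm) :
    dual c μ ν ρ₁ ρ₂ ε u v + ε * ∑ i, ∑ j, (NormedSpace.exp (kern c ρ₁ ρ₂ ε u v i j)).trace
      ≤ ρ₁ * ∑ i, (μ i).trace + ρ₂ * ∑ j, (ν j).trace := by
  have h1 : 0 ≤ ρ₁ * ∑ i, (expAddLog (u i) (μ i)).trace := mul_nonneg hρ₁.le
    (Finset.sum_nonneg fun i _ => (posSemidef_expAddLog (hu i) (μ i)).trace_nonneg)
  have h2 : 0 ≤ ρ₂ * ∑ j, (expAddLog (v j) (ν j)).trace := mul_nonneg hρ₂.le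
    (Finset.sum_nonneg fun j _ => (posSemidef_expAddLog (hv j) (ν j)).trace_nonneg)
  rw [dual_eq]
  linarith

/-- All exponential traces in the dual are nonnegative and enter with a minus sign, so a lower bound
on the dual value bounds each of them. This keeps the couplings in a compact set. -/
lemma trace_exp_kern_le (hc : ∀ i j, (c i j).IsSymm) (hρ₁ : 0 < ρ₁) (hρ₂ : 0 < ρ₂) (hε : 0 < ε)
    {u : I → Mat d} {v : J → Mat d} (hu : ∀ i, (u i).IsSymm) (hv : ∀ j, (v j).IsSymm)
    (i : I) (j : J) :
    (NormedSpace.exp (kern c ρ₁ ρ₂ ε u v i j)).trace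
      ≤ (ρ₁ * ∑ i, (μ i).trace + ρ₂ * ∑ j, (ν j).trace - dual c μ ν ρ₁ ρ₂ ε u v) / ε := by
  rw [le_div_iff₀ hε, mul_comm]
  have h1 := Finset.single_le_sum (fun j _ => trace_exp_kern_nonneg (ρ₁ := ρ₁) (ρ₂ := ρ₂) (ε := ε)
    hc hu hv i j) (Finset.mem_univ j)
  have h2 := Finset.single_le_sum
    (f := fun i => ∑ j, (NormedSpace.exp (kern c ρ₁ ρ₂ ε u v i j)).trace)
    (fun i _ => Finset.sum_nonneg fun j _ => trace_exp_kern_nonneg hc hu hv i j)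
    (Finset.mem_univ i)
  have h3 := mul_le_mul_of_nonneg_left (h1.trans h2) hε.le
  have h4 := dual_add_trace_le (c := c) (μ := μ) (ν := ν) (ε := ε) hρ₁ hρ₂ hu hv
  linarith

/-- The gradient of the dual objective, up to weights. -/
noncomputable def dualGrad (c : I → J → Mat d) (μ : I → Mat d) (ν : J → Mat d) (ρ₁ ρ₂ ε : ℝ)
    (z : (I → Mat d) × (J → Mat d)) : (I → Mat d) × (J → Mat d) :=
  (fun i => ∑ j, NormedSpace.exp (kern c ρ₁ ρ₂ ε z.1 z.2 i j) - expAddLog (z.1 i) (μ i),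
    fun j => ∑ i, NormedSpace.exp (kern c ρ₁ ρ₂ ε z.1 z.2 i j) - expAddLog (z.2 j) (ν j))

lemma continuous_dualGrad : Continuous (dualGrad c μ ν ρ₁ ρ₂ ε) := by
  have h3 (i : I) (j : J) : Continuous fun z : (I → Mat d) × (J → Mat d) =>
      NormedSpace.exp (kern c ρ₁ ρ₂ ε z.1 z.2 i j) := continuous_exp.comp (continuous_kern i j)
  refine Continuous.prodMk (continuous_pi fun i => ?_) (continuous_pi fun j => ?_)
  · exact (continuous_finsetSum _ fun j _ => h3 i j).sub
      ((continuous_expAddLog (μ i)).comp ((continuous_apply i).comp continuous_fst))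
  · exact (continuous_finsetSum _ fun i _ => h3 i j).sub
      ((continuous_expAddLog (ν j)).comp ((continuous_apply j).comp continuous_snd))

lemma isSymm_sum {ι : Type*} [Fintype ι] {f : ι → Mat d} (hf : ∀ i, (f i).IsSymm) :
    (∑ i, f i).IsSymm :=
  Finset.sum_induction f _ (fun _ _ ha hb => ha.add hb) Matrix.isSymm_zero fun i _ => hf i

lemma dualGrad_mem_symmPairs (hc : ∀ i j, (c i j).IsSymm) {z : (I → Mat d) × (J → Mat d)}
    (hz : z ∈ symmPairs I J d) : dualGrad c μ ν ρ₁ ρ₂ ε z ∈ symmPairs I J d :=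
  ⟨fun i => (isSymm_sum fun j => isSymm_exp (isSymm_kern hc hz.1 hz.2 i j)).sub
      (isSymm_expAddLog (hz.1 i) _),
    fun j => (isSymm_sum fun i => isSymm_exp (isSymm_kern hc hz.1 hz.2 i j)).sub
      (isSymm_expAddLog (hz.2 j) _)⟩

/-- The weighted inner product of pairs of families of matrices. -/
noncomputable def pairInner (ρ₁ ρ₂ : ℝ) (z w : (I → Mat d) × (J → Mat d)) : ℝ :=
  ρ₁ * ∑ i, (z.1 i * w.1 i).trace + ρ₂ * ∑ j, (z.2 j * w.2 j).trace

lemma pairInner_smul_right (z w : (I → Mat d) × (J → Mat d)) (t : ℝ) :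
    pairInner ρ₁ ρ₂ z (t • w) = t * pairInner ρ₁ ρ₂ z w := by
  simp only [pairInner, Prod.smul_fst, Prod.smul_snd, Pi.smul_apply, Matrix.mul_smul,
    Matrix.trace_smul, smul_eq_mul, ← Finset.mul_sum]
  ring

lemma pairInner_sub_smul_left (z z' w : (I → Mat d) × (J → Mat d)) (δ : ℝ) :
    pairInner ρ₁ ρ₂ (z - δ • z') w = pairInner ρ₁ ρ₂ z w - δ * pairInner ρ₁ ρ₂ z' w := by
  simp only [pairInner, Prod.fst_sub, Prod.snd_sub, Pi.sub_apply, Prod.smul_fst, Prod.smul_snd,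
    Pi.smul_apply, sub_mul, Matrix.smul_mul, Matrix.trace_sub, Matrix.trace_smul, smul_eq_mul,
    Finset.sum_sub_distrib, ← Finset.mul_sum]
  ring

lemma sqNorm_add_smul (z w : (I → Mat d) × (J → Mat d)) (t : ℝ) :
    sqNorm ρ₁ ρ₂ (z + t • w)
      = sqNorm ρ₁ ρ₂ z + 2 * t * pairInner ρ₁ ρ₂ z w + t ^ 2 * sqNorm ρ₁ ρ₂ w := by
  have h (A B : Mat d) : ((A + t • B) * (A + t • B)).trace
      = (A * A).trace + 2 * t * (A * B).trace + t ^ 2 * (B * B).trace := by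
    simp only [add_mul, mul_add, Matrix.smul_mul, Matrix.mul_smul, Matrix.trace_add,
      Matrix.trace_smul, smul_eq_mul, Matrix.trace_mul_comm B A]
    ring
  simp only [pairInner, sqNorm, Prod.fst_add, Prod.snd_add, Pi.add_apply, Prod.smul_fst,
    Prod.smul_snd, Pi.smul_apply, h, Finset.sum_add_distrib, ← Finset.mul_sum]
  ring

lemma continuous_pairInner_left (w : (I → Mat d) × (J → Mat d)) :
    Continuous fun z => pairInner ρ₁ ρ₂ z w := by
  unfold pairInner
  have h1 (i : I) : Continuous fun z : (I → Mat d) × (J → Mat d) => (z.1 i * w.1 i).trace :=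
    (continuous_trace_mul (w.1 i)).comp ((continuous_apply i).comp continuous_fst)
  have h2 (j : J) : Continuous fun z : (I → Mat d) × (J → Mat d) => (z.2 j * w.2 j).trace :=
    (continuous_trace_mul (w.2 j)).comp ((continuous_apply j).comp continuous_snd)
  fun_prop

lemma eq_zero_of_sqNorm_nonpos (hρ₁ : 0 < ρ₁) (hρ₂ : 0 < ρ₂) {z : (I → Mat d) × (J → Mat d)}
    (hz : z ∈ symmPairs I J d) (h : sqNorm ρ₁ ρ₂ z ≤ 0) : z = 0 := by
  obtain ⟨h1, h2⟩ := trace_mul_self_le_sqNorm hρ₁ hρ₂ hz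
  refine Prod.ext (funext fun i => ?_) (funext fun j => ?_)
  · exact eq_zero_of_trace_mul_self_nonpos (hz.1 i)
      ((h1 i).trans (div_nonpos_of_nonpos_of_nonneg h hρ₁.le))
  · exact eq_zero_of_trace_mul_self_nonpos (hz.2 j)
      ((h2 j).trans (div_nonpos_of_nonpos_of_nonneg h hρ₂.le))

/-- Stationarity of a maximizer of the dual objective with a quadratic penalty. -/
lemma dualGrad_eq_smul_of_max (hc : ∀ i j, (c i j).IsSymm) (hρ₁ : 0 < ρ₁) (hρ₂ : 0 < ρ₂)
    (hε : 0 < ε) {δ : ℝ} {z : (I → Mat d) × (J → Mat d)} (hz : z ∈ symmPairs I J d)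
    (hmax : ∀ z' ∈ symmPairs I J d, dual c μ ν ρ₁ ρ₂ ε z'.1 z'.2 - δ / 2 * sqNorm ρ₁ ρ₂ z'
      ≤ dual c μ ν ρ₁ ρ₂ ε z.1 z.2 - δ / 2 * sqNorm ρ₁ ρ₂ z) :
    dualGrad c μ ν ρ₁ ρ₂ ε z = δ • z := by
  set G : (I → Mat d) × (J → Mat d) → (I → Mat d) × (J → Mat d) := dualGrad c μ ν ρ₁ ρ₂ ε
  -- The gradient of the penalized objective, up to weights; the test direction is the gradient
  -- itself.
  set w := G z - δ • z
  have hws : w ∈ symmPairs I J d := symmPairs_sub_smul (dualGrad_mem_symmPairs hc hz) hz δ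
  -- The concavity inequality is used at the base point `z + t • w`, so no differentiability is
  -- needed. Dividing by `t` and letting `t → 0` leaves `sqNorm ρ₁ ρ₂ w ≤ 0`, by continuity of `G`.
  have key (t : ℝ) (ht : 0 < t) : pairInner ρ₁ ρ₂ (G (z + t • w)) w
      - δ * pairInner ρ₁ ρ₂ z w - t * (δ / 2 * sqNorm ρ₁ ρ₂ w) ≤ 0 := by
    have hzt := symmPairs_add_smul hz hws t
    have h1 := dual_sub_dual_le (μ := μ) (ν := ν) hc hρ₁ hρ₂ hε hzt.1 hzt.2 hz.1 hz.2
    have h2 := hmax _ hzt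
    have h3 : dual c μ ν ρ₁ ρ₂ ε z.1 z.2 - dual c μ ν ρ₁ ρ₂ ε (z + t • w).1 (z + t • w).2
        ≤ pairInner ρ₁ ρ₂ (G (z + t • w)) (-t • w) := by
      refine h1.trans_eq ?_
      simp only [pairInner, G, dualGrad, Prod.fst_add, Prod.snd_add, Pi.add_apply, Prod.smul_fst,
        Prod.smul_snd, Pi.smul_apply, sub_add_cancel_left, neg_smul,
        Prod.fst_neg, Prod.snd_neg, Pi.neg_apply]
    rw [pairInner_smul_right] at h3
    rw [sqNorm_add_smul] at h2
    have h4 : t * (pairInner ρ₁ ρ₂ (G (z + t • w)) w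
      - δ * pairInner ρ₁ ρ₂ z w - t * (δ / 2 * sqNorm ρ₁ ρ₂ w)) ≤ 0 := by nlinarith
    exact nonpos_of_mul_nonpos_right h4 ht
  have hcont : Continuous fun t : ℝ => pairInner ρ₁ ρ₂ (G (z + t • w)) w
      - δ * pairInner ρ₁ ρ₂ z w - t * (δ / 2 * sqNorm ρ₁ ρ₂ w) := by
    have h1 : Continuous fun t : ℝ => z + t • w := by fun_prop
    have hG : Continuous G := continuous_dualGrad
    have h2 := (continuous_pairInner_left (ρ₁ := ρ₁) (ρ₂ := ρ₂) w).comp (hG.comp h1)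
    exact (h2.sub continuous_const).sub (continuous_id.mul continuous_const)
  have hlim := (hcont.tendsto 0).mono_left (nhdsWithin_le_nhds (s := Set.Ioi 0))
  have hle := le_of_tendsto hlim (Filter.eventually_of_mem self_mem_nhdsWithin key)
  rw [zero_smul, add_zero, zero_mul, sub_zero, ← pairInner_sub_smul_left] at hle
  exact sub_eq_zero.1 (eq_zero_of_sqNorm_nonpos hρ₁ hρ₂ hws hle)

end

/-! ### Penalized maximizers and a coupling without duality gap. -/

section

variable {I J : Type*} [Fintype I] [Fintype J] {d : ℕ}
  {c : I → J → Mat d} {μ : I → Mat d} {ν : J → Mat d} {ρ₁ ρ₂ ε : ℝ}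

/-- Existence and properties of maximizers of the dual objective with a quadratic penalty. -/
lemma exists_penalized_max (hc : ∀ i j, (c i j).IsSymm) (hρ₁ : 0 < ρ₁) (hρ₂ : 0 < ρ₂)
    (hε : 0 < ε) {δ : ℝ} (hδ : 0 < δ) :
    ∃ z ∈ symmPairs I J d, dualGrad c μ ν ρ₁ ρ₂ ε z = δ • z ∧
      dual c μ ν ρ₁ ρ₂ ε 0 0 ≤ dual c μ ν ρ₁ ρ₂ ε z.1 z.2 ∧
      δ / 2 * sqNorm ρ₁ ρ₂ z
        ≤ ρ₁ * ∑ i, (μ i).trace + ρ₂ * ∑ j, (ν j).trace - dual c μ ν ρ₁ ρ₂ ε 0 0 := by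
  -- `M` bounds how far the dual can rise above its value at zero, uniformly in `δ`.
  set M := ρ₁ * ∑ i, (μ i).trace + ρ₂ * ∑ j, (ν j).trace - dual c μ ν ρ₁ ρ₂ ε 0 0
  set f : (I → Mat d) × (J → Mat d) → ℝ :=
    fun z => dual c μ ν ρ₁ ρ₂ ε z.1 z.2 - δ / 2 * sqNorm ρ₁ ρ₂ z with hf
  have hf0 : f 0 = dual c μ ν ρ₁ ρ₂ ε 0 0 := by
    simp [hf, sqNorm]
  have hle {z : (I → Mat d) × (J → Mat d)} (hz : z ∈ symmPairs I J d) (h : f 0 ≤ f z) :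
      δ / 2 * sqNorm ρ₁ ρ₂ z ≤ M := by
    have h1 := dual_add_trace_le (c := c) (μ := μ) (ν := ν) (ε := ε) hρ₁ hρ₂ hz.1 hz.2
    have h2 : 0 ≤ ε * ∑ i, ∑ j, (NormedSpace.exp (kern c ρ₁ ρ₂ ε z.1 z.2 i j)).trace :=
      mul_nonneg hε.le (Finset.sum_nonneg fun i _ => Finset.sum_nonneg fun j _ =>
        trace_exp_kern_nonneg hc hz.1 hz.2 i j)
    rw [hf0] at h
    simp only [hf] at h
    linarith
  obtain ⟨z, hz, hmax⟩ := exists_max_of_bounded_superlevel (f := f)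
    (C₁ := √(M / (δ / 2) / ρ₁)) (C₂ := √(M / (δ / 2) / ρ₂))
    (continuous_dual.sub (continuous_const.mul continuous_sqNorm)) (by
      intro z hz h
      have h1 : sqNorm ρ₁ ρ₂ z ≤ M / (δ / 2) := by
        rw [le_div_iff₀ (half_pos hδ), mul_comm]
        exact hle hz h
      obtain ⟨h2, h3⟩ := trace_mul_self_le_sqNorm hρ₁ hρ₂ hz
      exact ⟨fun i => mem_entryBox_of_trace_mul_self_le (hz.1 i)
          ((h2 i).trans (div_le_div_of_nonneg_right h1 hρ₁.le)),
        fun j => mem_entryBox_of_trace_mul_self_le (hz.2 j)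
          ((h3 j).trans (div_le_div_of_nonneg_right h1 hρ₂.le))⟩)
  have h0 : f 0 ≤ f z := hmax 0 ⟨fun _ => Matrix.isSymm_zero, fun _ => Matrix.isSymm_zero⟩
  refine ⟨z, hz, dualGrad_eq_smul_of_max hc hρ₁ hρ₂ hε hz hmax, ?_, hle hz h0⟩
  rw [hf0] at h0
  have := mul_nonneg (half_pos hδ).le (sqNorm_nonneg hρ₁ hρ₂ hz)
  simp only [hf] at h0
  linarith

lemma tendsto_zero_of_trace_mul_self {ι : Type*} {l : Filter ι} {A : ι → Mat d}
    (hA : ∀ n, (A n).IsSymm) (h : Filter.Tendsto (fun n => (A n * A n).trace) l (𝓝 0)) :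
    Filter.Tendsto A l (𝓝 0) := by
  refine tendsto_pi_nhds.2 fun a => tendsto_pi_nhds.2 fun b => ?_
  have h1 : Filter.Tendsto (fun n => √((A n * A n).trace)) l (𝓝 0) := by
    simpa using h.sqrt
  exact squeeze_zero_norm (fun n => Real.abs_le_sqrt (sq_apply_le_trace_mul_self (hA n) a b)) h1

/-- Lower semicontinuity of the primal objective. -/
lemma primalAux_leLiminf {ι : Type*} {l : Filter ι} (hρ₁ : 0 < ρ₁) (hρ₂ : 0 < ρ₂) (hε : 0 < ε)
    {X : ι → I → J → Mat d} {P : ι → I → Mat d} {Q : ι → J → Mat d}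
    {X' : I → J → Mat d} {P' : I → Mat d} {Q' : J → Mat d}
    (hX : ∀ n i j, (X n i j).PosSemidef) (hP : ∀ n i, (P n i).PosSemidef)
    (hQ : ∀ n j, (Q n j).PosSemidef) (hX' : ∀ i j, (X' i j).PosSemidef)
    (hP' : ∀ i, (P' i).PosSemidef) (hQ' : ∀ j, (Q' j).PosSemidef)
    (hXl : ∀ i j, Filter.Tendsto (fun n => X n i j) l (𝓝 (X' i j)))
    (hPl : ∀ i, Filter.Tendsto (fun n => P n i) l (𝓝 (P' i)))
    (hQl : ∀ j, Filter.Tendsto (fun n => Q n j) l (𝓝 (Q' j))) :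
    LELiminf l (fun n => primalAux c μ ν ρ₁ ρ₂ ε (X n) (P n) (Q n))
      (primalAux c μ ν ρ₁ ρ₂ ε X' P' Q') := by
  have htr {Y : ι → Mat d} {Y' : Mat d} (h : Filter.Tendsto Y l (𝓝 Y')) :
      Filter.Tendsto (fun n => (Y n).trace) l (𝓝 Y'.trace) :=
    ((continuous_id.matrix_trace).tendsto Y').comp h
  have hmul (B : Mat d) {Y : ι → Mat d} {Y' : Mat d} (h : Filter.Tendsto Y l (𝓝 Y')) :
      Filter.Tendsto (fun n => (Y n * B).trace) l (𝓝 (Y' * B).trace) :=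
    ((continuous_trace_mul B).tendsto Y').comp h
  have hS {Y : ι → Mat d} {Y' : Mat d} (hY : ∀ n, (Y n).PosSemidef) (hY' : Y'.PosSemidef)
      (h : Filter.Tendsto Y l (𝓝 Y')) :
      LELiminf l (fun n => traceMulLog (Y n)) (traceMulLog Y') :=
    fun η hη => eventually_lt_traceMulLog hY hY' h hη
  have hrel (B : Mat d) {Y : ι → Mat d} {Y' : Mat d} (hY : ∀ n, (Y n).PosSemidef)
      (hY' : Y'.PosSemidef) (h : Filter.Tendsto Y l (𝓝 Y')) :
      LELiminf l (fun n => relEntropy (Y n) B) (relEntropy Y' B) := by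
    have h1 := (hS hY hY' h).add (LELiminf.of_tendsto
      ((((hmul (mlog B) h).neg).sub (htr h)).add_const B.trace))
    simp only [relEntropy]
    convert h1 using 1
    · ext n; ring
    · ring
  unfold primalAux
  refine LELiminf.add (LELiminf.add (LELiminf.add ?_ (LELiminf.const_mul hρ₁ ?_))
    (LELiminf.const_mul hρ₂ ?_)) (LELiminf.const_mul hε ?_)
  · exact LELiminf.sum _ fun i => LELiminf.sum _ fun j => LELiminf.of_tendsto (hmul _ (hXl i j))
  · exact LELiminf.sum _ fun i => hrel _ (fun n => hP n i) (hP' i) (hPl i)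
  · exact LELiminf.sum _ fun j => hrel _ (fun n => hQ n j) (hQ' j) (hQl j)
  · refine LELiminf.sum _ fun i => LELiminf.sum _ fun j => ?_
    simp only [sub_eq_add_neg]
    exact (hS (fun n => hX n i j) (hX' i j) (hXl i j)).add (LELiminf.of_tendsto (htr (hXl i j)).neg)

/-- A feasible coupling without duality gap. -/
lemma exists_feasible_no_gap (hc : ∀ i j, (c i j).IsSymm) (hμ : ∀ i, (μ i).IsSymm)
    (hν : ∀ j, (ν j).IsSymm) (hρ₁ : 0 < ρ₁) (hρ₂ : 0 < ρ₂) (hε : 0 < ε) :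
    ∃ γ : I → J → Mat d, Feasible μ ν γ ∧ ∀ η : ℝ, 0 < η → ∃ z ∈ symmPairs I J d,
      primalReal c μ ν ρ₁ ρ₂ ε γ - η < dual c μ ν ρ₁ ρ₂ ε z.1 z.2 := by
  set M := ρ₁ * ∑ i, (μ i).trace + ρ₂ * ∑ j, (ν j).trace - dual c μ ν ρ₁ ρ₂ ε 0 0
  set δ : ℕ → ℝ := fun n => 1 / ((n : ℝ) + 1)
  have hδ (n : ℕ) : 0 < δ n := Nat.one_div_pos_of_nat
  choose z hz hgrad hge hsq using
    fun n => exists_penalized_max (μ := μ) (ν := ν) hc hρ₁ hρ₂ hε (hδ n)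
  -- Compactness is applied to the square roots of the couplings: their squared Frobenius norm is
  -- `tr (exp K)`, which is bounded, and the square of a symmetric limit is positive semidefinite.
  set Y : ℕ → I → J → Mat d := fun n i j => halfExp (kern c ρ₁ ρ₂ ε (z n).1 (z n).2 i j)
  have hK (n : ℕ) (i : I) (j : J) : (kern c ρ₁ ρ₂ ε (z n).1 (z n).2 i j).IsSymm :=
    isSymm_kern hc (hz n).1 (hz n).2 i j
  have hYY (n : ℕ) (i : I) (j : J) :
      Y n i j * Y n i j = NormedSpace.exp (kern c ρ₁ ρ₂ ε (z n).1 (z n).2 i j) :=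
    halfExp_mul_self (hK n i j)
  have hYmem (n : ℕ) : Y n ∈ Set.univ.pi fun _ : I => Set.univ.pi fun _ : J =>
      entryBox d (√(M / ε)) := by
    intro i _ j _
    refine mem_entryBox_of_trace_mul_self_le (isSymm_halfExp _) ?_
    rw [halfExp_mul_self (hK n i j)]
    refine (trace_exp_kern_le (μ := μ) (ν := ν) hc hρ₁ hρ₂ hε (hz n).1 (hz n).2 i j).trans ?_
    exact div_le_div_of_nonneg_right (sub_le_sub_left (hge n) _) hε.le
  have : FirstCountableTopology (Mat d) :=
    inferInstanceAs (FirstCountableTopology (Fin d → Fin d → ℝ))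
  obtain ⟨H, -, φ, hφ, hlim⟩ := (isCompact_univ_pi fun _ : I => isCompact_univ_pi fun _ : J =>
    isCompact_entryBox (d := d) (√(M / ε))).tendsto_subseq hYmem
  have hlimij (i : I) (j : J) : Filter.Tendsto (fun n => Y (φ n) i j) Filter.atTop (𝓝 (H i j)) :=
    tendsto_pi_nhds.1 (tendsto_pi_nhds.1 hlim i) j
  have hH (i : I) (j : J) : (H i j).IsSymm := by
    refine tendsto_nhds_unique (((continuous_id.matrix_transpose).tendsto _).comp (hlimij i j)) ?_
    refine (hlimij i j).congr fun n => ?_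
    exact (isSymm_halfExp _).eq.symm
  have hXlim (i : I) (j : J) : Filter.Tendsto
      (fun n => NormedSpace.exp (kern c ρ₁ ρ₂ ε (z (φ n)).1 (z (φ n)).2 i j)) Filter.atTop
      (𝓝 (H i j * H i j)) := by
    have hcont : Continuous fun A : Mat d => A * A := continuous_id.matrix_mul continuous_id
    exact ((hcont.tendsto _).comp (hlimij i j)).congr fun n => hYY (φ n) i j
  have hγ (i : I) (j : J) : (H i j * H i j).PosSemidef := by
    have := Matrix.posSemidef_conjTranspose_mul_self (H i j)
    rwa [Matrix.conjTranspose_eq_transpose_of_trivial, hH] at this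
  have hδφ : Filter.Tendsto (fun n => δ (φ n)) Filter.atTop (𝓝 0) :=
    tendsto_one_div_add_atTop_nhds_zero_nat.comp hφ.tendsto_atTop
  -- The potentials may be unbounded, but `δ |z|² ≤ 2 M` gives `|δ z|² ≤ 2 M δ → 0`.
  have hsmall {ρ : ℝ} (hρ : 0 < ρ) {A : ℕ → Mat d} (hA : ∀ n, (A n).IsSymm)
      (h : ∀ n, (A n * A n).trace ≤ sqNorm ρ₁ ρ₂ (z n) / ρ) :
      Filter.Tendsto (fun n => δ (φ n) • A (φ n)) Filter.atTop (𝓝 0) := by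
    refine tendsto_zero_of_trace_mul_self (fun n => (hA _).smul _) ?_
    refine squeeze_zero (g := fun n => δ (φ n) * (2 * M / ρ))
      (fun n => trace_mul_self_nonneg ((hA _).smul _)) (fun n => ?_) ?_
    · have h1 := hsq (φ n)
      have h2 := h (φ n)
      rw [le_div_iff₀ hρ] at h2
      rw [Matrix.smul_mul, Matrix.mul_smul, Matrix.trace_smul, Matrix.trace_smul, smul_eq_mul,
        smul_eq_mul]
      refine mul_le_mul_of_nonneg_left ?_ (hδ _).le
      rw [le_div_iff₀ hρ]
      nlinarith [mul_le_mul_of_nonneg_left h2 (hδ (φ n)).le]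
    · simpa using hδφ.mul_const (2 * M / ρ)
  -- By stationarity `expAddLog (u i) (μ i)` differs from the marginal of `exp K` by `δ • u i`, so
  -- both have the same limit.
  have hP (i : I) : Filter.Tendsto (fun n => expAddLog ((z (φ n)).1 i) (μ i)) Filter.atTop
      (𝓝 (∑ j, H i j * H i j)) := by
    have h1 := (tendsto_finsetSum Finset.univ fun j _ => hXlim i j).sub
      (hsmall hρ₁ (fun n => (hz n).1 i) fun n => (trace_mul_self_le_sqNorm hρ₁ hρ₂ (hz n)).1 i)
    rw [sub_zero] at h1
    refine h1.congr fun n => ?_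
    have := congrFun (congrArg Prod.fst (hgrad (φ n))) i
    simp only [dualGrad, Prod.smul_fst, Pi.smul_apply] at this
    rw [← this, sub_sub_cancel]
  have hQ (j : J) : Filter.Tendsto (fun n => expAddLog ((z (φ n)).2 j) (ν j)) Filter.atTop
      (𝓝 (∑ i, H i j * H i j)) := by
    have h1 := (tendsto_finsetSum Finset.univ fun i _ => hXlim i j).sub
      (hsmall hρ₂ (fun n => (hz n).2 j) fun n => (trace_mul_self_le_sqNorm hρ₁ hρ₂ (hz n)).2 j)
    rw [sub_zero] at h1
    refine h1.congr fun n => ?_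
    have := congrFun (congrArg Prod.snd (hgrad (φ n))) j
    simp only [dualGrad, Prod.smul_snd, Pi.smul_apply] at this
    rw [← this, sub_sub_cancel]
  -- The marginals of `γ` inherit the kernel condition as limits of `expAddLog`; the marginals of
  -- `exp K` do not satisfy it when the data are singular and `d` is positive.
  have hfix {P R : Mat d} {A : ℕ → Mat d} (hA : Filter.Tendsto A Filter.atTop (𝓝 P))
      (h : ∀ n, A n * R = A n) : P * R = P := by
    have hcont : Continuous fun A : Mat d => A * R := continuous_id.matrix_mul continuous_const
    exact tendsto_nhds_unique (((hcont.tendsto _).comp hA).congr h) hA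
  refine ⟨fun i j => H i j * H i j, ⟨hγ, fun i => hfix (hP i) fun n => expAddLog_mul_rangeProj _ _,
    fun j => hfix (hQ j) fun n => expAddLog_mul_rangeProj _ _⟩, fun η hη => ?_⟩
  have hlsc := primalAux_leLiminf (c := c) (μ := μ) (ν := ν) hρ₁ hρ₂ hε
    (fun n i j => posSemidef_exp (hK (φ n) i j))
    (fun n i => posSemidef_expAddLog ((hz (φ n)).1 i) (μ i))
    (fun n j => posSemidef_expAddLog ((hz (φ n)).2 j) (ν j)) hγ
    (fun i => posSemidef_sum (hγ i)) (fun j => posSemidef_sum fun i => hγ i j) hXlim hP hQ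
  obtain ⟨n, hn⟩ := (hlsc η hη).exists
  refine ⟨z (φ n), hz (φ n), hn.trans_le ?_⟩
  refine (primalAux_le_dual hc hμ hν hρ₁ hρ₂ hε (hz (φ n)).1 (hz (φ n)).2).trans ?_
  -- The error term in `primalAux_le_dual` is minus this quantity, which stationarity makes
  -- nonnegative.
  have h1 : pairInner ρ₁ ρ₂ (dualGrad c μ ν ρ₁ ρ₂ ε (z (φ n))) (z (φ n))
      = δ (φ n) * sqNorm ρ₁ ρ₂ (z (φ n)) := by
    rw [hgrad]
    have := pairInner_sub_smul_left (ρ₁ := ρ₁) (ρ₂ := ρ₂) 0 (z (φ n)) (z (φ n)) (-δ (φ n))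
    rw [neg_smul, zero_sub, neg_neg] at this
    rw [this]
    simp [pairInner, sqNorm]
  have h2 := mul_nonneg (hδ (φ n)).le (sqNorm_nonneg hρ₁ hρ₂ (hz (φ n)))
  rw [← h1] at h2
  simp only [pairInner, dualGrad] at h2
  linarith

end

/-! ### Dual attainment for nonsingular data, and convergence of couplings. -/

section

section UpperBound

variable {d : ℕ}

/-- `C` is an upper bound for the eigenvalues of `A`. -/
def EigenLE (A : Mat d) (C : ℝ) : Prop := (C • (1 : Mat d) - A).PosSemidef

lemma trace_cfc {A : Mat d} (hA : A.IsHermitian) (f : ℝ → ℝ) :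
    (cfc f A).trace = ∑ i, f (hA.eigenvalues i) := by
  rw [hA.cfc_eq, Matrix.IsHermitian.cfc, Unitary.conjStarAlgAut_apply, Matrix.trace_mul_cycle,
    Unitary.coe_star_mul_self, one_mul, Matrix.trace_diagonal]
  rfl

/-- Every eigenvalue satisfies `x ≤ exp x`, and `exp x` is one of the positive summands of the
trace. -/
lemma eigenLE_trace_exp {A : Mat d} (hA : A.IsSymm) : EigenLE A (NormedSpace.exp A).trace := by
  have hA' : A.IsHermitian := isSelfAdjoint_of_isSymm hA
  set C := (NormedSpace.exp A).trace with hC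
  have e : C • (1 : Mat d) - A = cfc (fun x : ℝ => C * 1 - x) A := by
    rw [cfc_sub _ _ _ (continuousOn_spectrum _ _) (continuousOn_spectrum _ _),
      cfc_const_mul _ _ _ (continuousOn_spectrum _ _), cfc_one_fun hA, cfc_id_fun hA]
  rw [EigenLE, e]
  refine posSemidef_cfc fun x hx => ?_
  obtain ⟨i, rfl⟩ := hA'.spectrum_real_eq_range_eigenvalues ▸ hx
  have h1 : Real.exp (hA'.eigenvalues i) ≤ C := by
    rw [hC, exp_eq_cfc hA, trace_cfc hA']
    exact Finset.single_le_sum (f := fun i => Real.exp (hA'.eigenvalues i))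
      (fun i _ => (Real.exp_pos _).le) (Finset.mem_univ i)
  have h2 := Real.add_one_le_exp (hA'.eigenvalues i)
  linarith

lemma EigenLE.add {A B : Mat d} {C D : ℝ} (hA : EigenLE A C) (hB : EigenLE B D) :
    EigenLE (A + B) (C + D) := by
  have := Matrix.PosSemidef.add hA hB
  rwa [sub_add_sub_comm, ← add_smul] at this

lemma EigenLE.smul {A : Mat d} {C r : ℝ} (hr : 0 ≤ r) (hA : EigenLE A C) :
    EigenLE (r • A) (r * C) := by
  have := Matrix.PosSemidef.smul hA hr
  rwa [smul_sub, smul_smul] at this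

lemma EigenLE.mono {A : Mat d} {C D : ℝ} (hA : EigenLE A C) (h : C ≤ D) : EigenLE A D := by
  have := Matrix.PosSemidef.add hA (Matrix.PosSemidef.one.smul (sub_nonneg.2 h))
  rwa [sub_add_eq_add_sub, ← add_smul, add_sub_cancel] at this

lemma exists_eigenLE {ι : Type*} [Fintype ι] {A : ι → Mat d} (hA : ∀ i, (A i).IsSymm) :
    ∃ C, ∀ i, EigenLE (A i) C :=
  ⟨∑ i, (NormedSpace.exp (A i)).trace, fun i => (eigenLE_trace_exp (hA i)).mono
    (Finset.single_le_sum (f := fun i => (NormedSpace.exp (A i)).trace)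
      (fun i _ => (posSemidef_exp (hA i)).trace_nonneg) (Finset.mem_univ i))⟩

/-- For nonnegative eigenvalues, the square of the sum dominates the sum of squares. -/
lemma trace_mul_self_le_sq_trace {X : Mat d} (hX : X.PosSemidef) :
    (X * X).trace ≤ X.trace ^ 2 := by
  have hXs := isSymm_of_posSemidef hX
  have h1 : X * X = cfc (fun x : ℝ => x * x) X := by rw [← cfc_mul_cfc, cfc_id_fun hXs]
  have h2 : X.trace = ∑ i, hX.1.eigenvalues i := by
    conv_lhs => rw [← cfc_id_fun hXs]
    rw [trace_cfc hX.1]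
  rw [h1, trace_cfc hX.1, h2, sq, Finset.sum_mul_sum]
  refine Finset.sum_le_sum fun i _ => ?_
  exact Finset.single_le_sum (f := fun j => hX.1.eigenvalues i * hX.1.eigenvalues j)
    (fun j _ => mul_nonneg (hX.eigenvalues_nonneg i) (hX.eigenvalues_nonneg j)) (Finset.mem_univ i)

/-- The shifted matrix `D + A` is positive semidefinite, so its entries are at most its trace, which
is at most `(C + D) * d`. Undoing the shift costs `|D|`. -/
lemma mem_entryBox_of_eigenLE {A : Mat d} {C D : ℝ} (h1 : EigenLE A C) (h2 : EigenLE (-A) D) :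
    A ∈ entryBox d ((C + D) * d + |D|) := by
  have h2' : (D • (1 : Mat d) + A).PosSemidef := by rwa [EigenLE, sub_neg_eq_add] at h2
  have ht1 := Matrix.PosSemidef.trace_nonneg h1
  have ht2 := h2'.trace_nonneg
  simp only [Matrix.trace_sub, Matrix.trace_add, Matrix.trace_smul, Matrix.trace_one,
    Fintype.card_fin, smul_eq_mul] at ht1 ht2
  have hbox := mem_entryBox_of_trace_mul_self_le (isSymm_of_posSemidef h2')
    (trace_mul_self_le_sq_trace h2')
  rw [Real.sqrt_sq h2'.trace_nonneg] at hbox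
  intro a b
  have hab := abs_le.2 (hbox a b)
  have e : A a b = (D • (1 : Mat d) + A) a b - D * (1 : Mat d) a b := by
    simp
  have h3 : |D * (1 : Mat d) a b| ≤ |D| := by
    rw [abs_mul]
    refine mul_le_of_le_one_right (abs_nonneg D) ?_
    rw [Matrix.one_apply]
    split_ifs <;> simp
  refine abs_le.1 ?_
  rw [e]
  refine (abs_sub _ _).trans (add_le_add (hab.trans ?_) h3)
  simp only [Matrix.trace_add, Matrix.trace_smul, Matrix.trace_one, Fintype.card_fin, smul_eq_mul]
  linarith

end UpperBound

variable {I J : Type*} [Fintype I] [Fintype J] {d : ℕ}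
  {c : I → J → Mat d} {μ : I → Mat d} {ν : J → Mat d} {ρ₁ ρ₂ ε : ℝ}

lemma trace_expAddLog_le (hc : ∀ i j, (c i j).IsSymm) (hρ₁ : 0 < ρ₁) (hρ₂ : 0 < ρ₂) (hε : 0 < ε)
    {u : I → Mat d} {v : J → Mat d} (hu : ∀ i, (u i).IsSymm) (hv : ∀ j, (v j).IsSymm) :
    (∀ i, (expAddLog (u i) (μ i)).trace
      ≤ (ρ₁ * ∑ i, (μ i).trace + ρ₂ * ∑ j, (ν j).trace - dual c μ ν ρ₁ ρ₂ ε u v) / ρ₁) ∧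
    ∀ j, (expAddLog (v j) (ν j)).trace
      ≤ (ρ₁ * ∑ i, (μ i).trace + ρ₂ * ∑ j, (ν j).trace - dual c μ ν ρ₁ ρ₂ ε u v) / ρ₂ := by
  have h1 (i : I) := (posSemidef_expAddLog (hu i) (μ i)).trace_nonneg
  have h2 (j : J) := (posSemidef_expAddLog (hv j) (ν j)).trace_nonneg
  have h1s := mul_nonneg hρ₁.le (Finset.sum_nonneg fun i (_ : i ∈ Finset.univ) => h1 i)
  have h2s := mul_nonneg hρ₂.le (Finset.sum_nonneg fun j (_ : j ∈ Finset.univ) => h2 j)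
  have h3 : 0 ≤ ε * ∑ i, ∑ j, (NormedSpace.exp (kern c ρ₁ ρ₂ ε u v i j)).trace :=
    mul_nonneg hε.le (Finset.sum_nonneg fun i _ => Finset.sum_nonneg fun j _ =>
      trace_exp_kern_nonneg hc hu hv i j)
  constructor
  · intro i
    rw [le_div_iff₀ hρ₁, dual_eq]
    have := mul_le_mul_of_nonneg_left
      (Finset.single_le_sum (fun i _ => h1 i) (Finset.mem_univ i)) hρ₁.le
    linarith
  · intro j
    rw [le_div_iff₀ hρ₂, dual_eq]
    have := mul_le_mul_of_nonneg_left
      (Finset.single_le_sum (fun j _ => h2 j) (Finset.mem_univ j)) hρ₂.le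
    linarith

/-- For nonsingular data the dual objective attains its maximum. -/
lemma exists_dual_max [Nonempty I] [Nonempty J] (hc : ∀ i j, (c i j).IsSymm)
    (hμ : ∀ i, (μ i).PosDef) (hν : ∀ j, (ν j).PosDef) (hρ₁ : 0 < ρ₁) (hρ₂ : 0 < ρ₂)
    (hε : 0 < ε) :
    ∃ z ∈ symmPairs I J d, ∀ z' ∈ symmPairs I J d,
      dual c μ ν ρ₁ ρ₂ ε z'.1 z'.2 ≤ dual c μ ν ρ₁ ρ₂ ε z.1 z.2 := by
  set M := ρ₁ * ∑ i, (μ i).trace + ρ₂ * ∑ j, (ν j).trace - dual c μ ν ρ₁ ρ₂ ε 0 0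
  -- For positive definite `Q` the range projection is `1`, so the exponent is `u + log Q` in full
  -- and all of `u` is bounded above.
  have hlog {u Q : Mat d} {C L : ℝ} (hu : u.IsSymm) (hQ : Q.PosDef) (hL : EigenLE (-mlog Q) L)
      (h : (expAddLog u Q).trace ≤ C) : EigenLE u (C + L) := by
    have hle : (NormedSpace.exp (expoAddLog u Q)).trace ≤ C := by
      rwa [← mul_one (NormedSpace.exp _), ← rangeProj_of_posDef hQ, ← expAddLog_eq]
    have h1 := ((eigenLE_trace_exp (isSymm_expoAddLog hu Q)).mono hle).add hL
    rwa [expoAddLog, rangeProj_of_posDef hQ, one_mul, mul_one, add_neg_cancel_right] at h1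
  obtain ⟨L₁, hL₁⟩ := exists_eigenLE fun i => (isSymm_mlog (μ i)).neg
  obtain ⟨L₂, hL₂⟩ := exists_eigenLE fun j => (isSymm_mlog (ν j)).neg
  obtain ⟨L, hL⟩ := exists_eigenLE fun p : I × J => hc p.1 p.2
  -- `D₁`, `D₂` bound the potentials from above. The primed constants bound their negatives: `K ≤ M
  -- / ε` reads `-ρ₁ u ≤ ε (M / ε) + c + ρ₂ v`, with `c ≤ L` and `v ≤ D₂`, and symmetrically.
  set D₁ := M / ρ₁ + L₁
  set D₂ := M / ρ₂ + L₂
  set D₁' := ρ₁⁻¹ * (ε * (M / ε) + L + ρ₂ * D₂)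
  set D₂' := ρ₂⁻¹ * (ε * (M / ε) + L + ρ₁ * D₁)
  refine exists_max_of_bounded_superlevel (f := fun z => dual c μ ν ρ₁ ρ₂ ε z.1 z.2)
    (C₁ := (D₁ + D₁') * d + |D₁'|) (C₂ := (D₂ + D₂') * d + |D₂'|) continuous_dual
    fun z hz h => ?_
  have hle : ρ₁ * ∑ i, (μ i).trace + ρ₂ * ∑ j, (ν j).trace - dual c μ ν ρ₁ ρ₂ ε z.1 z.2 ≤ M :=
    sub_le_sub_left h _
  obtain ⟨hE, hF⟩ := trace_expAddLog_le (μ := μ) (ν := ν) hc hρ₁ hρ₂ hε hz.1 hz.2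
  have hu (i : I) : EigenLE (z.1 i) D₁ := hlog (hz.1 i) (hμ i) (hL₁ i)
    ((hE i).trans (div_le_div_of_nonneg_right hle hρ₁.le))
  have hv (j : J) : EigenLE (z.2 j) D₂ := hlog (hz.2 j) (hν j) (hL₂ j)
    ((hF j).trans (div_le_div_of_nonneg_right hle hρ₂.le))
  have hK (i : I) (j : J) :
      EigenLE (-(c i j + ρ₁ • z.1 i + ρ₂ • z.2 j) + c i j) (ε * (M / ε) + L) := by
    have h1 := (eigenLE_trace_exp (isSymm_kern (ρ₁ := ρ₁) (ρ₂ := ρ₂) (ε := ε) hc hz.1 hz.2 i j)).mono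
      ((trace_exp_kern_le (μ := μ) (ν := ν) hc hρ₁ hρ₂ hε hz.1 hz.2 i j).trans
        (div_le_div_of_nonneg_right hle hε.le))
    have h2 := h1.smul hε.le
    rw [kern, smul_neg, smul_inv_smul₀ hε.ne'] at h2
    exact h2.add (hL (i, j))
  constructor
  · intro i
    -- A lower bound on `u i` comes from any one kernel `K i j`.
    obtain ⟨j⟩ := ‹Nonempty J›
    refine mem_entryBox_of_eigenLE (hu i) ?_
    have h1 := ((hK i j).add ((hv j).smul hρ₂.le)).smul (inv_nonneg.2 hρ₁.le)
    have e : -(c i j + ρ₁ • z.1 i + ρ₂ • z.2 j) + c i j + ρ₂ • z.2 j = ρ₁ • -z.1 i := by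
      rw [smul_neg]; abel
    rwa [e, inv_smul_smul₀ hρ₁.ne'] at h1
  · intro j
    obtain ⟨i⟩ := ‹Nonempty I›
    refine mem_entryBox_of_eigenLE (hv j) ?_
    have h1 := ((hK i j).add ((hu i).smul hρ₁.le)).smul (inv_nonneg.2 hρ₂.le)
    have e : -(c i j + ρ₁ • z.1 i + ρ₂ • z.2 j) + c i j + ρ₁ • z.1 i = ρ₂ • -z.2 j := by
      rw [smul_neg]; abel
    rwa [e, inv_smul_smul₀ hρ₂.ne'] at h1

lemma dual_le_primalReal (hc : ∀ i j, (c i j).IsSymm) (hμ : ∀ i, (μ i).IsSymm)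
    (hν : ∀ j, (ν j).IsSymm) (hρ₁ : 0 < ρ₁) (hρ₂ : 0 < ρ₂) (hε : 0 < ε) {γ : I → J → Mat d}
    (hγ : Feasible μ ν γ) {u : I → Mat d} {v : J → Mat d} (hu : ∀ i, (u i).IsSymm)
    (hv : ∀ j, (v j).IsSymm) : dual c μ ν ρ₁ ρ₂ ε u v ≤ primalReal c μ ν ρ₁ ρ₂ ε γ := by
  refine le_trans ?_ (dual_add_le_primalReal hc hμ hν hρ₁ hρ₂ hε hγ hu hv)
  exact le_add_of_nonneg_right (mul_nonneg hε.le (Finset.sum_nonneg fun i _ =>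
    Finset.sum_nonneg fun j _ =>
      trace_mul_self_nonneg ((isSymm_msqrt _).sub (isSymm_halfExp _))))

/-- Along a sequence of dual pairs whose duality gap with `γ` vanishes, the couplings converge. -/
lemma tendsto_exp_kern (hc : ∀ i j, (c i j).IsSymm) (hμ : ∀ i, (μ i).IsSymm)
    (hν : ∀ j, (ν j).IsSymm) (hρ₁ : 0 < ρ₁) (hρ₂ : 0 < ρ₂) (hε : 0 < ε) {γ : I → J → Mat d}
    (hγ : Feasible μ ν γ) {ι : Type*} {l : Filter ι} {u : ι → I → Mat d} {v : ι → J → Mat d}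
    (hu : ∀ n i, (u n i).IsSymm) (hv : ∀ n j, (v n j).IsSymm)
    (h : Filter.Tendsto (fun n => dual c μ ν ρ₁ ρ₂ ε (u n) (v n)) l
      (𝓝 (primalReal c μ ν ρ₁ ρ₂ ε γ))) (i : I) (j : J) :
    Filter.Tendsto (fun n => NormedSpace.exp (kern c ρ₁ ρ₂ ε (u n) (v n) i j)) l (𝓝 (γ i j)) := by
  set B : ι → I → J → Mat d :=
    fun n i j => msqrt (γ i j) - halfExp (kern c ρ₁ ρ₂ ε (u n) (v n) i j) with hB
  have hBs (n : ι) (i : I) (j : J) : (B n i j).IsSymm := (isSymm_msqrt _).sub (isSymm_halfExp _)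
  have hnn (n : ι) (i : I) (j : J) := trace_mul_self_nonneg (hBs n i j)
  -- The duality gap dominates each remainder term, so the half exponentials converge to `√γ`, and
  -- squaring gives the claim.
  have hle (n : ι) : (B n i j * B n i j).trace
      ≤ (primalReal c μ ν ρ₁ ρ₂ ε γ - dual c μ ν ρ₁ ρ₂ ε (u n) (v n)) / ε := by
    rw [le_div_iff₀ hε, mul_comm]
    have h0 := dual_add_le_primalReal hc hμ hν hρ₁ hρ₂ hε hγ (hu n) (hv n)
    have h1 := Finset.single_le_sum (fun j _ => hnn n i j) (Finset.mem_univ j)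
    have h2 := Finset.single_le_sum (f := fun i => ∑ j, (B n i j * B n i j).trace)
      (fun i _ => Finset.sum_nonneg fun j _ => hnn n i j) (Finset.mem_univ i)
    have h3 := mul_le_mul_of_nonneg_left (h1.trans h2) hε.le
    simp only [hB] at h3 ⊢
    linarith
  have hlim : Filter.Tendsto (fun n => B n i j) l (𝓝 0) := by
    refine tendsto_zero_of_trace_mul_self (fun n => hBs n i j)
      (squeeze_zero (fun n => hnn n i j) hle ?_)
    have := (h.const_sub (primalReal c μ ν ρ₁ ρ₂ ε γ)).div_const ε
    rwa [sub_self, zero_div] at this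
  have hhalf := hlim.const_sub (msqrt (γ i j))
  rw [sub_zero] at hhalf
  have hcont : Continuous fun A : Mat d => A * A := continuous_id.matrix_mul continuous_id
  have hsq := (hcont.tendsto _).comp hhalf
  simp only [msqrt_mul_self (hγ.posSemidef i j)] at hsq
  refine hsq.congr fun n => ?_
  simp only [Function.comp, hB, sub_sub_cancel]
  exact halfExp_mul_self (isSymm_kern hc (hu n) (hv n) i j)

end

end QOT

/-! ### Assembly of the main theorem. -/

theorem proposition1 {I J : Type*} [Fintype I] [Fintype J] [Nonempty I] [Nonempty J] (d : ℕ)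
    (c : I → J → QOT.Mat d) (hc : ∀ i j, (c i j).IsSymm)
    (μ : I → QOT.Mat d) (hμ : ∀ i, (μ i).PosSemidef)
    (ν : J → QOT.Mat d) (hν : ∀ j, (ν j).PosSemidef)
    (ρ₁ ρ₂ ε : ℝ) (hρ₁ : 0 < ρ₁) (hρ₂ : 0 < ρ₂) (hε : 0 < ε) :
    -- strong duality
    IsLUB (QOT.dualValues c μ ν ρ₁ ρ₂ ε) (QOT.W c μ ν ρ₁ ρ₂ ε) ∧
    -- the dual supremum is a maximum if the data are nonsingular
    ((∀ i, (μ i).PosDef) → (∀ j, (ν j).PosDef) →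
      IsGreatest (QOT.dualValues c μ ν ρ₁ ρ₂ ε) (QOT.W c μ ν ρ₁ ρ₂ ε)) ∧
    -- the primal infimum is attained at exactly one coupling
    ∃ γ : I → J → QOT.Mat d,
      (∀ γ' : I → J → QOT.Mat d,
        QOT.primal c μ ν ρ₁ ρ₂ ε γ' = QOT.W c μ ν ρ₁ ρ₂ ε ↔ γ' = γ) ∧
      -- primal-dual relation at a dual solution
      (∀ (u : I → QOT.Mat d) (v : J → QOT.Mat d), QOT.IsDualSolution c μ ν ρ₁ ρ₂ ε u v →
        ∀ i j, γ i j = NormedSpace.exp (QOT.kern c ρ₁ ρ₂ ε u v i j)) ∧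
      -- primal-dual relation along a dual maximizing sequence
      (∀ (u : ℕ → I → QOT.Mat d) (v : ℕ → J → QOT.Mat d),
        (∀ n i, (u n i).IsSymm) → (∀ n j, (v n j).IsSymm) →
        Filter.Tendsto (fun n => (QOT.dual c μ ν ρ₁ ρ₂ ε (u n) (v n) : EReal)) Filter.atTop
          (𝓝 (QOT.W c μ ν ρ₁ ρ₂ ε)) →
        ∀ i j, Filter.Tendsto
          (fun n => NormedSpace.exp (QOT.kern c ρ₁ ρ₂ ε (u n) (v n) i j)) Filter.atTop
          (𝓝 (γ i j))) := by
  have hμs (i : I) := QOT.isSymm_of_posSemidef (hμ i)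
  have hνs (j : J) := QOT.isSymm_of_posSemidef (hν j)
  obtain ⟨γ, hγ, hgap⟩ := QOT.exists_feasible_no_gap hc hμs hνs hρ₁ hρ₂ hε
  set p := QOT.primalReal c μ ν ρ₁ ρ₂ ε γ
  have hweak (u : I → QOT.Mat d) (v : J → QOT.Mat d) (hu : ∀ i, (u i).IsSymm)
      (hv : ∀ j, (v j).IsSymm) : QOT.dual c μ ν ρ₁ ρ₂ ε u v ≤ p :=
    QOT.dual_le_primalReal hc hμs hνs hρ₁ hρ₂ hε hγ hu hv
  have hmin (γ' : I → J → QOT.Mat d) (hγ' : QOT.Feasible μ ν γ') :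
      p ≤ QOT.primalReal c μ ν ρ₁ ρ₂ ε γ' := by
    refine le_of_forall_pos_lt_add fun η hη => ?_
    obtain ⟨z, hz, hlt⟩ := hgap η hη
    have := QOT.dual_le_primalReal hc hμs hνs hρ₁ hρ₂ hε hγ' hz.1 hz.2
    linarith
  have hW : QOT.W c μ ν ρ₁ ρ₂ ε = (p : EReal) := by
    refine le_antisymm ((iInf_le _ γ).trans_eq (QOT.primal_eq hμs hνs hγ)) (le_iInf fun γ' => ?_)
    by_cases hγ' : QOT.Feasible μ ν γ'
    · rw [QOT.primal_eq hμs hνs hγ']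
      exact EReal.coe_le_coe_iff.2 (hmin γ' hγ')
    · rw [QOT.primal_eq_top hμs hνs hρ₁ hρ₂ hε hγ']
      exact le_top
  have hlub : IsLUB (QOT.dualValues c μ ν ρ₁ ρ₂ ε) (p : EReal) := by
    constructor
    · rintro x ⟨u, v, hu, hv, rfl⟩
      exact EReal.coe_le_coe_iff.2 (hweak u v hu hv)
    · intro b hb
      by_contra hlt
      obtain ⟨r, hbr, hrp⟩ := EReal.lt_iff_exists_real_btwn.1 (not_le.1 hlt)
      obtain ⟨z, hz, hzlt⟩ := hgap (p - r) (sub_pos.2 (EReal.coe_lt_coe_iff.1 hrp))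
      rw [sub_sub_cancel] at hzlt
      have := hb ⟨z.1, z.2, hz.1, hz.2, rfl⟩
      exact absurd (EReal.coe_lt_coe_iff.2 hzlt) (not_lt.2 (this.trans hbr.le))
  rw [hW]
  refine ⟨hlub, fun hμ' hν' => ⟨?_, hlub.1⟩, γ, fun γ' => ⟨fun h => ?_, ?_⟩, ?_, ?_⟩
  · obtain ⟨z, hz, hmax⟩ := QOT.exists_dual_max (c := c) hc hμ' hν' hρ₁ hρ₂ hε
    refine ⟨z.1, z.2, hz.1, hz.2, le_antisymm (hlub.2 ?_) ?_⟩
    · rintro x ⟨u, v, hu, hv, rfl⟩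
      exact EReal.coe_le_coe_iff.2 (hmax (u, v) ⟨hu, hv⟩)
    · exact EReal.coe_le_coe_iff.2 (hweak z.1 z.2 hz.1 hz.2)
  · have hγ' : QOT.Feasible μ ν γ' := by
      by_contra hn
      rw [QOT.primal_eq_top hμs hνs hρ₁ hρ₂ hε hn] at h
      exact EReal.coe_ne_top p h.symm
    rw [QOT.primal_eq hμs hνs hγ', EReal.coe_eq_coe_iff] at h
    -- Uniqueness: along one dual maximizing sequence, `exp K` converges to every primal minimizer.
    choose z hz hlt using fun n : ℕ => hgap (1 / ((n : ℝ) + 1)) Nat.one_div_pos_of_nat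
    have hlim : Filter.Tendsto (fun n => QOT.dual c μ ν ρ₁ ρ₂ ε (z n).1 (z n).2) Filter.atTop
        (𝓝 p) := by
      have h1 := (tendsto_one_div_add_atTop_nhds_zero_nat (𝕜 := ℝ)).const_sub p
      rw [sub_zero] at h1
      exact tendsto_of_tendsto_of_tendsto_of_le_of_le h1 tendsto_const_nhds
        (fun n => (hlt n).le) fun n => hweak _ _ (hz n).1 (hz n).2
    funext i j
    exact tendsto_nhds_unique
      (QOT.tendsto_exp_kern hc hμs hνs hρ₁ hρ₂ hε hγ' (fun n => (hz n).1) (fun n => (hz n).2)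
        (by rw [h]; exact hlim) i j)
      (QOT.tendsto_exp_kern hc hμs hνs hρ₁ hρ₂ hε hγ (fun n => (hz n).1) (fun n => (hz n).2)
        hlim i j)
  · rintro rfl
    exact QOT.primal_eq hμs hνs hγ
  · intro u v ⟨hu, hv, hmax⟩ i j
    have hval : QOT.dual c μ ν ρ₁ ρ₂ ε u v = p := by
      refine le_antisymm (hweak u v hu hv) (le_of_forall_pos_lt_add fun η hη => ?_)
      obtain ⟨z, hz, hlt⟩ := hgap η hη
      have := hmax z.1 z.2 hz.1 hz.2
      linarith
    -- A dual maximizer is treated as a constant maximizing sequence.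
    exact tendsto_nhds_unique tendsto_const_nhds (QOT.tendsto_exp_kern
      (l := (Filter.atTop : Filter ℕ)) hc hμs hνs hρ₁ hρ₂ hε hγ (fun _ => hu) (fun _ => hv)
      (by rw [hval]; exact tendsto_const_nhds) i j) |>.symm
  · intro u v hu hv hlim
    exact QOT.tendsto_exp_kern hc hμs hνs hρ₁ hρ₂ hε hγ hu hv (EReal.tendsto_coe.1 hlim)
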